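/- **Notation.** Let $w_0=\left(\begin{smallmatrix}&&1\\&-1&\\1&&\end{smallmatrix}\right)$, let $B$ be the group of upper triangular matrices in $\mathrm{SL}_3(\mathbb R)$, $\mathrm U$ its subgroup of unipotent matrices, and $\Gamma_\infty=\mathrm U(\mathbb Z)$; write $A\sim A'$ if $\Gamma_\infty A\Gamma_\infty=\Gamma_\infty A'\Gamma_\infty$. For a $3\times3$ matrix $A$ let $M_{ij}$ be the minor obtained by deleting row $i$ and column $j$. Put $t(c_1,c_2)=\mathrm{diag}(c_1,c_2/c_1,1/c_2)$, $e(z)=e^{2\pi i z}$, $\psi_{\vec n}(u)=e(n_1u_{12}+n_2u_{23})$ for $u\in\mathrm U(\mathbb R)$, and for $c\ne0$ $$S(m,n;c)=\sum_{\substack{a,d\ (\mathrm{mod}\ c)\\ ad\equiv1\ (\mathrm{mod}\ c)}}e\Big(\frac{ma+nd}{c}\Big).$$ Let $\iota_\alpha(g)$ and $\iota_\beta(g)$ be the block matrices $\mathrm{diag}(g,1)$ and $\mathrm{diag}(1,g)$ for a $2\times2$ matrix $g$, and for $\delta\in\{\alpha,\beta\}$ let $e_\delta(x)=\iota_\delta\left(\begin{smallmatrix}1&x\\0&1\end{smallmatrix}\right)$,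 $h_\delta(c)=\iota_\delta\left(\begin{smallmatrix}c&0\\0&1/c\end{smallmatrix}\right)$, $s_\delta=\iota_\delta\left(\begin{smallmatrix}0&-1\\1&0\end{smallmatrix}\right)$; thus $w_0=s_\beta s_\alpha s_\beta$. **Proposition.** (1) For every $A\in\mathrm{SL}_3(\mathbb Z)\cap Bw_0B$, $$\gcd(A_{31},A_{21})=\gcd(M_{13},M_{12}).$$ Let now $d_1,d_2$ be nonzero integers and $f$ a positive integer, and define $$\Omega:=\Omega_{(\beta,\alpha,\beta)}(d_1,d_2,f)=\{A\in\mathrm{SL}_3(\mathbb Z):\ \gcd(A_{31},A_{21})=f,\ A_{31}=d_1f,\ M_{13}=d_2f\}.$$ (2) $\Omega$ is contained in $Bw_0B$ and in $\mathrm U(\mathbb R)\,w_0\,t(d_1f,d_2f)\,\mathrm U(\mathbb R)$, and it is invariant under left and right multiplication by $\Gamma_\infty$. (3) Every $A\in\Omega$ is equivalent to some $A'\sim A$ with $A'_{11}M'_{11}-1\neq0$. If $A\in\Omega$ and $A_{11}M_{11}-1\ne0$, then $A_{11}M_{11}-1=fD$ with a nonzero integer $D$, and $$A=e_\beta\Big(\tfrac{A_{21}/f}{d_1}\Big)s_\beta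 h_\beta(d_1)e_\beta\Big(\tfrac{M_{21}/D}{d_1}\Big)\cdot e_\alpha\Big(\tfrac{A_{11}}{f}\Big)s_\alpha h_\alpha(f)e_\alpha\Big(\tfrac{M_{11}}{f}\Big)\cdot e_\beta\Big(\tfrac{A_{12}/D}{d_2}\Big)s_\beta h_\beta(d_2)e_\beta\Big(\tfrac{M_{12}/f}{d_2}\Big).$$ Equivalently, with $x_1=A_{21}/f$, $y_1=M_{21}/D$, $x_2=A_{12}/D$, $y_2=M_{12}/f$, $x_3=A_{11}$, $y_3=M_{11}$ and $b_i=(x_iy_i-1)/d_i$ for $i=1,2$, $$A=\iota_\beta\begin{pmatrix}x_1&b_1\\d_1&y_1\end{pmatrix}\iota_\alpha\begin{pmatrix}x_3&D\\f&y_3\end{pmatrix}\iota_\beta\begin{pmatrix}x_2&b_2\\d_2&y_2\end{pmatrix}.$$ Here $x_1,y_2,x_3,y_3$ and $u:=x_2d_1+x_3d_2y_1$, $v:=x_2d_1y_3+d_2y_1$ are integers, and $$A=\begin{pmatrix}1&\frac{u}{d_2f}&\frac{x_3}{d_1f}\\&1&\frac{x_1}{d_1}\\&&1\end{pmatrix}w_0\begin{pmatrix}d_1f&&\\&\frac{d_2}{d_1}&\\&&\frac1{d_2f}\end{pmatrix}\begin{pmatrix}1&\frac{v}{d_1f}&\frac{y_2v-y_3d_1}{d_1d_2f}\\&1&\frac{y_2}{d_2}\\&&1\end{pmatrix}.\qquad(*)$$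 (4) For integers $x_1,y_2,x_3,y_3,u,v$, the right-hand side of $(*)$ lies in $Bw_0B\cap\mathrm{SL}_3(\mathbb Z)$ if and only if $x_3y_3\equiv1\ (\mathrm{mod}\ f)$, $x_1v\equiv d_2\ (\mathrm{mod}\ d_1)$, $y_2v\equiv y_3d_1\ (\mathrm{mod}\ d_2)$, $x_3v\equiv u\ (\mathrm{mod}\ d_1f)$, $x_1y_2v\equiv y_3x_1d_1+y_2d_2\ (\mathrm{mod}\ d_1d_2)$ and $x_3y_2v+d_1(1-x_3y_3)\equiv uy_2\ (\mathrm{mod}\ d_1d_2f)$. (5) For $A\in\Omega$ and integers $x_3,y_3$, there is $A'\sim A$ with $A'_{11}=x_3$ and $M'_{11}=y_3$ if and only if $x_3\equiv A_{11}$ and $y_3\equiv M_{11}\ (\mathrm{mod}\ f)$. If $A\in\Omega$ and $B\in\mathrm{SL}_3(\mathbb Z)$ are given by $(*)$ with integral coordinates $(x_1,y_2,x_3,y_3,u,v)$ and $(X_1,Y_2,x_3,y_3,U,V)$ respectively (the same $d_1,d_2,f,x_3,y_3$), then $A\sim B$ if and only if $$u\equiv U\ (\mathrm{mod}\ d_1d_2f),\qquad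 x_1\equiv X_1\ (\mathrm{mod}\ d_1),\qquad y_2\equiv Y_2\ (\mathrm{mod}\ d_2).$$ (6) The set $\Gamma_\infty\backslash\Omega/\Gamma_\infty$ is finite, and for $\vec m,\vec n\in\mathbb Z^2$ and $A=u_Lw_0t(d_1f,d_2f)u_R\in\Omega$ with $u_L,u_R\in\mathrm U(\mathbb R)$ the number $\psi_{\vec m}(u_L)\psi_{\vec n}(u_R)$ depends only on the double coset of $A$. The fine Kloosterman sum is $$\sum_{\substack{A\in\Gamma_\infty\backslash\Omega/\Gamma_\infty\\A=u_Lw_0t(d_1f,d_2f)u_R}}\psi_{\vec m}(u_L)\psi_{\vec n}(u_R)=f\sum_{\substack{x_3,y_3\ (\mathrm{mod}\ f)\\x_3y_3\equiv1\ (\mathrm{mod}\ f)\\n_1d_2+x_3m_1d_1\equiv0\ (\mathrm{mod}\ f)}}S\Big(\frac{n_1d_2+x_3m_1d_1}{f},m_2;d_1\Big)\,S\Big(\frac{n_1d_2y_3+m_1d_1}{f},n_2;d_2\Big).$$ -/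

import Mathlib

open scoped MatrixGroups

noncomputable section

namespace SL3Kloosterman

/-- Upper triangular `3 × 3` matrices with ones on the diagonal. -/
def IsUnipotent {R : Type*} [CommRing R] (u : Matrix (Fin 3) (Fin 3) R) : Prop :=
  u 1 0 = 0 ∧ u 2 0 = 0 ∧ u 2 1 = 0 ∧ u 0 0 = 1 ∧ u 1 1 = 1 ∧ u 2 2 = 1

/-- The group `Γ_∞ = U(ℤ)` of integral unipotent upper triangular matrices. -/
def GammaInf : Subgroup SL(3, ℤ) where
  carrier := {g | IsUnipotent (g : Matrix (Fin 3) (Fin 3) ℤ)}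
  one_mem' := by simp [IsUnipotent]
  mul_mem' := by
    intro a b ha hb
    obtain ⟨a1, a2, a3, a4, a5, a6⟩ := ha
    obtain ⟨b1, b2, b3, b4, b5, b6⟩ := hb
    simp [IsUnipotent, Matrix.mul_apply, Fin.sum_univ_three, a1, a2, a3, a4, a5, a6,
      b1, b2, b3, b4, b5, b6]
  inv_mem' := by
    intro a ha
    obtain ⟨a1, a2, a3, a4, a5, a6⟩ := ha
    simp only [Set.mem_ofPred_eq, IsUnipotent, Matrix.SpecialLinearGroup.coe_inv,
      Matrix.adjugate_fin_three]
    simp [a1, a2, a3, a4, a5, a6]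

/-- `A ∼ B` : the matrices lie in the same `Γ_∞`-double coset. -/
def Equivalent (A B : SL(3, ℤ)) : Prop :=
  ∃ g ∈ GammaInf, ∃ h ∈ GammaInf, A = g * B * h

/-- The integral matrix `A`, viewed with real entries. -/
def toReal (A : SL(3, ℤ)) : Matrix (Fin 3) (Fin 3) ℝ :=
  (A : Matrix (Fin 3) (Fin 3) ℤ).map (fun a => (a : ℝ))

/-- The minor obtained by deleting row `i` and column `j` (indices counted from `0`,
so that `M₁₃` is `delMinor A 0 2`). -/
def delMinor {R : Type*} [CommRing R] (A : Matrix (Fin 3) (Fin 3) R) (i j : Fin 3) : R :=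
  (A.submatrix i.succAbove j.succAbove).det

/-- The embedding of `2 × 2` matrices attached to the simple root `α = (1, -1, 0)`. -/
def iotaAlpha (g : Matrix (Fin 2) (Fin 2) ℝ) : Matrix (Fin 3) (Fin 3) ℝ :=
  !![g 0 0, g 0 1, 0; g 1 0, g 1 1, 0; 0, 0, 1]

/-- The embedding of `2 × 2` matrices attached to the simple root `β = (0, 1, -1)`. -/
def iotaBeta (g : Matrix (Fin 2) (Fin 2) ℝ) : Matrix (Fin 3) (Fin 3) ℝ :=
  !![1, 0, 0; 0, g 0 0, g 0 1; 0, g 1 0, g 1 1]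

def eAlpha (x : ℝ) : Matrix (Fin 3) (Fin 3) ℝ := iotaAlpha !![1, x; 0, 1]

def eBeta (x : ℝ) : Matrix (Fin 3) (Fin 3) ℝ := iotaBeta !![1, x; 0, 1]

def hAlpha (c : ℝ) : Matrix (Fin 3) (Fin 3) ℝ := iotaAlpha !![c, 0; 0, 1 / c]

def hBeta (c : ℝ) : Matrix (Fin 3) (Fin 3) ℝ := iotaBeta !![c, 0; 0, 1 / c]

def sAlpha : Matrix (Fin 3) (Fin 3) ℝ := iotaAlpha !![0, -1; 1, 0]

def sBeta : Matrix (Fin 3) (Fin 3) ℝ := iotaBeta !![0, -1; 1, 0]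

/-- The long Weyl element, as a matrix. -/
def wLong : Matrix (Fin 3) (Fin 3) ℝ := !![0, 0, 1; 0, -1, 0; 1, 0, 0]

theorem wLong_eq_alpha_beta_alpha : wLong = sAlpha * sBeta * sAlpha := by
  ext i j
  fin_cases i <;> fin_cases j <;>
    simp [wLong, sAlpha, sBeta, iotaAlpha, iotaBeta, Matrix.mul_apply, Fin.sum_univ_three]

theorem wLong_eq_beta_alpha_beta : wLong = sBeta * sAlpha * sBeta := by
  ext i j
  fin_cases i <;> fin_cases j <;>
    simp [wLong, sAlpha, sBeta, iotaAlpha, iotaBeta, Matrix.mul_apply, Fin.sum_univ_three]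

/-- The torus element `t(c₁, c₂) = diag(c₁, c₂ / c₁, 1 / c₂)`. -/
def torus (c₁ c₂ : ℝ) : Matrix (Fin 3) (Fin 3) ℝ :=
  Matrix.diagonal ![c₁, c₂ / c₁, 1 / c₂]

/-- The integral points of the big Bruhat cell `B w₀ B`, where `B` is the group of upper
triangular matrices in `SL₃(ℝ)`. -/
def bigCell : Set SL(3, ℤ) :=
  {A | ∃ b b' : SL(3, ℝ),
    (b : Matrix (Fin 3) (Fin 3) ℝ).BlockTriangular id ∧
    (b' : Matrix (Fin 3) (Fin 3) ℝ).BlockTriangular id ∧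
    toReal A = (b : Matrix (Fin 3) (Fin 3) ℝ) * wLong * (b' : Matrix (Fin 3) (Fin 3) ℝ)}

/-- `A = u_L w₀ t(c₁, c₂) u_R` with `u_L, u_R` real unipotent upper triangular matrices. -/
def IsBruhat (A : SL(3, ℤ)) (c₁ c₂ : ℤ) (uL uR : Matrix (Fin 3) (Fin 3) ℝ) : Prop :=
  IsUnipotent uL ∧ IsUnipotent uR ∧ toReal A = uL * wLong * torus c₁ c₂ * uR

/-- The coarse Kloosterman set `Ω_{w₀}(c₁, c₂)`. -/
def coarseSet (c₁ c₂ : ℤ) : Set SL(3, ℤ) :=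
  {A | ∃ uL uR, IsBruhat A c₁ c₂ uL uR}

/-- The stratum `Ω_{(β,α,β)}(d₁, d₂, f)`:
`gcd(A₃₁, A₂₁) = f`, `A₃₁ = d₁ f` and `M₁₃ = d₂ f`. -/
def stratum (d₁ d₂ : ℤ) (f : ℕ) : Set SL(3, ℤ) :=
  {A | Int.gcd (A 2 0) (A 1 0) = f ∧ A 2 0 = d₁ * f ∧
    delMinor (A : Matrix (Fin 3) (Fin 3) ℤ) 0 2 = d₂ * f}

/-- The product `u_L w₀ t(d₁ f, d₂ f) u_R` in the coordinates `x₁, y₂, x₃, y₃, u, v`. -/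
def coordMatrix (d₁ d₂ : ℤ) (f : ℕ) (x₁ y₂ x₃ y₃ u v : ℤ) : Matrix (Fin 3) (Fin 3) ℝ :=
  !![1, (u : ℝ) / (d₂ * f), (x₃ : ℝ) / (d₁ * f);
     0, 1, (x₁ : ℝ) / d₁;
     0, 0, 1] * wLong * torus (d₁ * f) (d₂ * f) *
  !![1, (v : ℝ) / (d₁ * f), ((y₂ : ℝ) * v - y₃ * d₁) / (d₁ * d₂ * f);
     0, 1, (y₂ : ℝ) / d₂;
     0, 0, 1]

/-- `e(z) = exp(2 π i z)`. -/
def expo (z : ℝ) : ℂ := Complex.exp (2 * Real.pi * Complex.I * z)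

/-- The additive character `ψ_n(u) = e(n₁ u₁₂ + n₂ u₂₃)`, with `n = ![n₁, n₂]`. -/
def psi (n : Fin 2 → ℤ) (u : Matrix (Fin 3) (Fin 3) ℝ) : ℂ :=
  expo (n 0 * u 0 1 + n 1 * u 1 2)

open Classical in
/-- The summand `ψ_m(u_L) ψ_n(u_R)` attached to `A = u_L w₀ t(c₁, c₂) u_R`
(for `c₁, c₂ ≠ 0` the matrices `u_L, u_R` are unique). -/
def kloostermanTerm (m n : Fin 2 → ℤ) (c₁ c₂ : ℤ) (A : SL(3, ℤ)) : ℂ :=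
  if h : ∃ p : Matrix (Fin 3) (Fin 3) ℝ × Matrix (Fin 3) (Fin 3) ℝ, IsBruhat A c₁ c₂ p.1 p.2
  then psi m h.choose.1 * psi n h.choose.2 else 0

/-- The set of double cosets `Γ_∞ \ X / Γ_∞` of a set `X` of matrices. -/
def doubleCosets (X : Set SL(3, ℤ)) :
    Set (DoubleCoset.Quotient (GammaInf : Set SL(3, ℤ)) (GammaInf : Set SL(3, ℤ))) :=
  (DoubleCoset.mk GammaInf GammaInf) '' X

/-- The sum of `ψ_m(u_L) ψ_n(u_R)` over `A = u_L w₀ t(c₁, c₂) u_R` in `Γ_∞ \ X / Γ_∞`;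
for `X = Ω_{w₀}(c₁, c₂)` this is the coarse Kloosterman sum of the long element. -/
def kloostermanSumOver (X : Set SL(3, ℤ)) (m n : Fin 2 → ℤ) (c₁ c₂ : ℤ) : ℂ :=
  ∑ᶠ q ∈ doubleCosets X, kloostermanTerm m n c₁ c₂ q.out

/-- The fine Kloosterman sum attached to `Ω_{(β,α,β)}(d₁, d₂, f)`. -/
def fineKloostermanSum (m n : Fin 2 → ℤ) (d₁ d₂ : ℤ) (f : ℕ) : ℂ :=
  kloostermanSumOver (stratum d₁ d₂ f) m n (d₁ * f) (d₂ * f)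

open Classical in
/-- The classical Kloosterman sum `S(m, n; c)`, the sum of `e((m a + n d) / c)` over residues
`a, d` modulo `c` with `a d ≡ 1 (mod c)`; the modulus `c ≠ 0` may be negative. -/
def classicalKloosterman (m n c : ℤ) : ℂ :=
  ∑ p ∈ (Finset.range c.natAbs ×ˢ Finset.range c.natAbs).filter
      (fun p : ℕ × ℕ => (p.1 : ℤ) * p.2 ≡ 1 [ZMOD c]),
    expo ((m : ℝ) * p.1 / c + (n : ℝ) * p.2 / c)

end SL3Kloosterman

end

/-! The Bruhat coordinates of `A` are entries and minors of `A`: `x₁f, x₃` and `d₁f` fill the first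
column, `y₃, y₂f, d₂f` are the minors along the first row, `v = A₃₂` and `u = M₂₃`. Multiplying out
`(*)` and using `det A = 1` shows that prescribing these eight numbers is the same as prescribing
`A` (`toReal_eq_coordMatrix_iff`), so everything becomes integer arithmetic.

Translations by `Γ_∞` act affinely on these numbers (`unipotent_translate`). They move `x₁` modulo
`d₁`, `y₂` modulo `d₂` and, by Bézout, `x₃` and `y₃` modulo `f`. Once `x₃` is fixed, coprimality of
`x₁` and `d₁` lets `u` move only by multiples of `d₁d₂f`, and then `v` follows from determinant
identities (`equivalent_iff_of_hasCoords`).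

To count double cosets, take inverses `y₁` of `x₁` modulo `d₁` and `x₂` of `y₂` modulo `d₂`.
Integrality forces `u ≡ x₃d₂y₁ + d₁x₂` modulo `d₁d₂` (`HasCoords.dvd_sub`), so a residue `w` modulo
`f` is the only remaining freedom, and every choice occurs (`exists_mem_stratum_hasCoords`). The
summand is a character in `w` times a function of `(y₁, x₁)` times a function of `(x₂, y₂)`. The sum
over `w` yields the factor `f` and the congruence condition; the other two sums are classical
Kloosterman sums. -/

namespace SL3Kloosterman

/-! ### Minors and the gcd identity. -/

section Minors

variable {R : Type*} [CommRing R] (A : Matrix (Fin 3) (Fin 3) R)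

theorem delMinor_zero_zero : delMinor A 0 0 = A 1 1 * A 2 2 - A 1 2 * A 2 1 := by
  simp [delMinor, Matrix.det_fin_two]

theorem delMinor_zero_one : delMinor A 0 1 = A 1 0 * A 2 2 - A 1 2 * A 2 0 := by
  simp [delMinor, Matrix.det_fin_two, Fin.succAbove]

theorem delMinor_zero_two : delMinor A 0 2 = A 1 0 * A 2 1 - A 1 1 * A 2 0 := by
  simp [delMinor, Matrix.det_fin_two, Fin.succAbove]

theorem delMinor_one_zero : delMinor A 1 0 = A 0 1 * A 2 2 - A 0 2 * A 2 1 := by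
  simp [delMinor, Matrix.det_fin_two, Fin.succAbove]

theorem delMinor_one_two : delMinor A 1 2 = A 0 0 * A 2 1 - A 0 1 * A 2 0 := by
  simp [delMinor, Matrix.det_fin_two, Fin.succAbove]

end Minors

theorem toReal_apply (A : SL(3, ℤ)) (i j : Fin 3) : toReal A i j = (A i j : ℝ) := rfl

theorem toReal_injective : Function.Injective toReal := by
  intro A B h
  ext i j
  exact Int.cast_injective (congrFun (congrFun h i) j)

theorem det_expand (A : SL(3, ℤ)) :
    A 0 0 * A 1 1 * A 2 2 - A 0 0 * A 1 2 * A 2 1 - A 0 1 * A 1 0 * A 2 2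
      + A 0 1 * A 1 2 * A 2 0 + A 0 2 * A 1 0 * A 2 1 - A 0 2 * A 1 1 * A 2 0 = 1 := by
  rw [← Matrix.det_fin_three]
  exact A.2

/-- Both minors are integral combinations of `A₂₁` and `A₃₁`. Conversely, since `det A = 1`, the `2
× 2` minors of the cofactor matrix are again entries of `A`: `A₃₁ = M₁₂M₂₃ - M₁₃M₂₂` and `A₂₁ =
M₁₂M₃₃ - M₁₃M₃₂`. -/
theorem gcd_column_eq_gcd_minors (A : SL(3, ℤ)) :
    Int.gcd (A 2 0) (A 1 0) =
      Int.gcd (delMinor (A : Matrix (Fin 3) (Fin 3) ℤ) 0 2)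
        (delMinor (A : Matrix (Fin 3) (Fin 3) ℤ) 0 1) := by
  have hdet := det_expand A
  rw [delMinor_zero_two, delMinor_zero_one]
  apply Nat.dvd_antisymm
  · apply Int.dvd_gcd
    · exact dvd_sub (Dvd.dvd.mul_right (Int.gcd_dvd_right ..) _)
        (Dvd.dvd.mul_left (Int.gcd_dvd_left ..) _)
    · exact dvd_sub (Dvd.dvd.mul_right (Int.gcd_dvd_right ..) _)
        (Dvd.dvd.mul_left (Int.gcd_dvd_left ..) _)
  · have h1 := Int.gcd_dvd_left (A 1 0 * A 2 1 - A 1 1 * A 2 0) (A 1 0 * A 2 2 - A 1 2 * A 2 0)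
    have h2 := Int.gcd_dvd_right (A 1 0 * A 2 1 - A 1 1 * A 2 0) (A 1 0 * A 2 2 - A 1 2 * A 2 0)
    apply Int.dvd_gcd
    · have h : A 2 0 = (A 1 0 * A 2 2 - A 1 2 * A 2 0) * (A 0 0 * A 2 1 - A 0 1 * A 2 0)
          - (A 1 0 * A 2 1 - A 1 1 * A 2 0) * (A 0 0 * A 2 2 - A 0 2 * A 2 0) := by
        linear_combination (-A 2 0) * hdet
      exact (dvd_sub (h2.mul_right _) (h1.mul_right _)).trans (dvd_of_eq h.symm)
    · have h : A 1 0 = (A 1 0 * A 2 2 - A 1 2 * A 2 0) * (A 0 0 * A 1 1 - A 0 1 * A 1 0)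
          - (A 1 0 * A 2 1 - A 1 1 * A 2 0) * (A 0 0 * A 1 2 - A 0 2 * A 1 0) := by
        linear_combination (-A 1 0) * hdet
      exact (dvd_sub (h2.mul_right _) (h1.mul_right _)).trans (dvd_of_eq h.symm)

/-! ### Unipotent translations and equivalence. -/

/-- The integral unipotent matrix with entries `k, l` in the first row and `m` in the second. -/
def unipotent (k l m : ℤ) : SL(3, ℤ) :=
  ⟨!![1, k, l; 0, 1, m; 0, 0, 1], by simp [Matrix.det_fin_three]⟩

theorem coe_unipotent (k l m : ℤ) :
    (unipotent k l m : Matrix (Fin 3) (Fin 3) ℤ) = !![1, k, l; 0, 1, m; 0, 0, 1] := rfl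

theorem unipotent_mem_GammaInf (k l m : ℤ) : unipotent k l m ∈ GammaInf := by
  change IsUnipotent (unipotent k l m : Matrix (Fin 3) (Fin 3) ℤ)
  simp [IsUnipotent, unipotent]

theorem exists_eq_unipotent {g : SL(3, ℤ)} (hg : g ∈ GammaInf) :
    ∃ k l m : ℤ, g = unipotent k l m := by
  obtain ⟨h1, h2, h3, h4, h5, h6⟩ : IsUnipotent (g : Matrix (Fin 3) (Fin 3) ℤ) := hg
  refine ⟨g 0 1, g 0 2, g 1 2, ?_⟩
  ext i j
  fin_cases i <;> fin_cases j <;> simp [unipotent, h1, h2, h3, h4, h5, h6]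

theorem equivalent_iff_exists_unipotent {A B : SL(3, ℤ)} :
    Equivalent A B ↔
      ∃ k l m k' l' m' : ℤ, A = unipotent k l m * B * unipotent k' l' m' := by
  constructor
  · rintro ⟨g, hg, h, hh, rfl⟩
    obtain ⟨k, l, m, rfl⟩ := exists_eq_unipotent hg
    obtain ⟨k', l', m', rfl⟩ := exists_eq_unipotent hh
    exact ⟨k, l, m, k', l', m', rfl⟩
  · rintro ⟨k, l, m, k', l', m', h⟩
    exact ⟨_, unipotent_mem_GammaInf .., _, unipotent_mem_GammaInf .., h⟩

theorem Equivalent.refl (A : SL(3, ℤ)) : Equivalent A A :=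
  ⟨1, one_mem _, 1, one_mem _, by simp⟩

theorem Equivalent.symm {A B : SL(3, ℤ)} (h : Equivalent A B) : Equivalent B A := by
  obtain ⟨g, hg, k, hk, rfl⟩ := h
  exact ⟨g⁻¹, inv_mem hg, k⁻¹, inv_mem hk, by group⟩

theorem Equivalent.trans {A B C : SL(3, ℤ)} (h : Equivalent A B) (h' : Equivalent B C) :
    Equivalent A C := by
  obtain ⟨g, hg, k, hk, rfl⟩ := h
  obtain ⟨g', hg', k', hk', rfl⟩ := h'
  exact ⟨g * g', mul_mem hg hg', k' * k, mul_mem hk' hk, by group⟩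

/-- The effect of a two-sided unipotent translation on the entries and minors that serve as
coordinates. -/
theorem unipotent_translate (B : SL(3, ℤ)) (k l m k' l' m' : ℤ) {C : SL(3, ℤ)}
    (hC : C = unipotent k l m * B * unipotent k' l' m') :
    C 2 0 = B 2 0 ∧ C 1 0 = B 1 0 + m * B 2 0 ∧ C 0 0 = B 0 0 + k * B 1 0 + l * B 2 0 ∧
    C 2 1 = B 2 1 + k' * B 2 0 ∧
    delMinor (C : Matrix (Fin 3) (Fin 3) ℤ) 0 2 = delMinor (B : Matrix (Fin 3) (Fin 3) ℤ) 0 2 ∧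
    delMinor (C : Matrix (Fin 3) (Fin 3) ℤ) 0 1 = delMinor (B : Matrix (Fin 3) (Fin 3) ℤ) 0 1
      + m' * delMinor (B : Matrix (Fin 3) (Fin 3) ℤ) 0 2 ∧
    delMinor (C : Matrix (Fin 3) (Fin 3) ℤ) 0 0 = delMinor (B : Matrix (Fin 3) (Fin 3) ℤ) 0 0
      + k' * delMinor (B : Matrix (Fin 3) (Fin 3) ℤ) 0 1
      + (k' * m' - l') * delMinor (B : Matrix (Fin 3) (Fin 3) ℤ) 0 2 ∧
    delMinor (C : Matrix (Fin 3) (Fin 3) ℤ) 1 2 = delMinor (B : Matrix (Fin 3) (Fin 3) ℤ) 1 2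
      + k * delMinor (B : Matrix (Fin 3) (Fin 3) ℤ) 0 2 := by
  subst hC
  simp only [delMinor_zero_zero, delMinor_zero_one, delMinor_zero_two, delMinor_one_two]
  simp only [Matrix.SpecialLinearGroup.coe_mul, coe_unipotent, Matrix.mul_apply,
    Fin.sum_univ_three]
  simp only [Matrix.of_apply, Matrix.cons_val]
  refine ⟨?_, ?_, ?_, ?_, ?_, ?_, ?_, ?_⟩ <;> ring

/-! ### Bruhat coordinates as entries and minors. -/

/-- The entries and minors of `A` that determine its coordinates. -/
def HasCoords (A : SL(3, ℤ)) (d₁ d₂ : ℤ) (f : ℕ) (x₁ y₂ x₃ y₃ u v : ℤ) : Prop :=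
  A 2 0 = d₁ * f ∧ A 1 0 = x₁ * f ∧ A 0 0 = x₃ ∧ A 2 1 = v ∧
  delMinor (A : Matrix (Fin 3) (Fin 3) ℤ) 0 2 = d₂ * f ∧
  delMinor (A : Matrix (Fin 3) (Fin 3) ℤ) 0 1 = y₂ * f ∧
  delMinor (A : Matrix (Fin 3) (Fin 3) ℤ) 0 0 = y₃ ∧
  delMinor (A : Matrix (Fin 3) (Fin 3) ℤ) 1 2 = u

theorem torus_eq (c₁ c₂ : ℝ) :
    torus c₁ c₂ = !![c₁, 0, 0; 0, c₂ / c₁, 0; 0, 0, 1 / c₂] := by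
  ext i j
  fin_cases i <;> fin_cases j <;> simp [torus]

section Coordinates

variable {d₁ d₂ : ℤ} {f : ℕ}

theorem coordMatrix_eq (hd₁ : d₁ ≠ 0) (hd₂ : d₂ ≠ 0) (hf : f ≠ 0) (x₁ y₂ x₃ y₃ u v : ℤ) :
    coordMatrix d₁ d₂ f x₁ y₂ x₃ y₃ u v =
      !![(x₃ : ℝ), ((x₃ : ℝ) * v - u) / (d₁ * f),
          ((x₃ : ℝ) * y₂ * v + d₁ * (1 - x₃ * y₃) - u * y₂) / (d₁ * d₂ * f);
        (x₁ : ℝ) * f, ((x₁ : ℝ) * v - d₂) / d₁,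
          ((x₁ : ℝ) * y₂ * v - (y₃ * x₁ * d₁ + y₂ * d₂)) / (d₁ * d₂);
        (d₁ : ℝ) * f, (v : ℝ), ((y₂ : ℝ) * v - y₃ * d₁) / d₂] := by
  have h1 : (d₁ : ℝ) ≠ 0 := by exact_mod_cast hd₁
  have h2 : (d₂ : ℝ) ≠ 0 := by exact_mod_cast hd₂
  have h3 : (f : ℝ) ≠ 0 := by exact_mod_cast hf
  ext i j
  fin_cases i <;> fin_cases j <;>
    simp [coordMatrix, wLong, torus_eq, Matrix.mul_apply, Fin.sum_univ_three] <;>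
    field_simp <;> ring

theorem toReal_eq_coordMatrix_iff_entries (hd₁ : d₁ ≠ 0) (hd₂ : d₂ ≠ 0) (hf : f ≠ 0)
    (M : Matrix (Fin 3) (Fin 3) ℤ) (x₁ y₂ x₃ y₃ u v : ℤ) :
    M.map (fun a => (a : ℝ)) = coordMatrix d₁ d₂ f x₁ y₂ x₃ y₃ u v ↔
      (M 0 0 = x₃ ∧ M 0 1 * (d₁ * f) = x₃ * v - u ∧
        M 0 2 * (d₁ * d₂ * f) = x₃ * y₂ * v + d₁ * (1 - x₃ * y₃) - u * y₂) ∧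
      (M 1 0 = x₁ * f ∧ M 1 1 * d₁ = x₁ * v - d₂ ∧
        M 1 2 * (d₁ * d₂) = x₁ * y₂ * v - (y₃ * x₁ * d₁ + y₂ * d₂)) ∧
      M 2 0 = d₁ * f ∧ M 2 1 = v ∧ M 2 2 * d₂ = y₂ * v - y₃ * d₁ := by
  have h1 : (d₁ : ℝ) ≠ 0 := by exact_mod_cast hd₁
  have h2 : (d₂ : ℝ) ≠ 0 := by exact_mod_cast hd₂
  have h3 : (f : ℝ) ≠ 0 := by exact_mod_cast hf
  rw [coordMatrix_eq hd₁ hd₂ hf, ← Matrix.ext_iff]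
  simp only [Fin.forall_fin_succ, Fin.forall_fin_zero, Matrix.map_apply]
  simp [eq_div_iff, h1, h2, h3]
  norm_cast

/-- Four of the five remaining entries are recovered from the prescribed minors after cancelling
`f`; `A₁₃` comes from the determinant. -/
theorem toReal_eq_coordMatrix_iff (hd₁ : d₁ ≠ 0) (hd₂ : d₂ ≠ 0) (hf : f ≠ 0) (A : SL(3, ℤ))
    (x₁ y₂ x₃ y₃ u v : ℤ) :
    toReal A = coordMatrix d₁ d₂ f x₁ y₂ x₃ y₃ u v ↔
      HasCoords A d₁ d₂ f x₁ y₂ x₃ y₃ u v := by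
  have hf' : (f : ℤ) ≠ 0 := by exact_mod_cast hf
  have hdet := det_expand A
  rw [toReal, toReal_eq_coordMatrix_iff_entries hd₁ hd₂ hf]
  simp only [HasCoords, delMinor_zero_zero, delMinor_zero_one, delMinor_zero_two,
    delMinor_one_two]
  constructor
  · rintro ⟨⟨h00, h01, h02⟩, ⟨h10, h11, h12⟩, h20, h21, h22⟩
    refine ⟨h20, h10, h00, h21, ?_, ?_, ?_, ?_⟩
    · rw [h10, h21, h20]
      linear_combination (-(f : ℤ)) * h11
    · apply mul_right_cancel₀ hd₂
      rw [h10, h20]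
      linear_combination (x₁ * (f : ℤ)) * h22 - (f : ℤ) * h12
    · apply mul_right_cancel₀ (mul_ne_zero hd₁ hd₂)
      rw [h21]
      linear_combination (A 2 2 * d₂) * h11 + (x₁ * v - d₂) * h22 - v * h12
    · rw [h00, h21, h20]
      linear_combination -h01
  · rintro ⟨h20, h10, h00, h21, h02', h01', h00', h12'⟩
    rw [h20, h10, h21] at h02'
    rw [h20, h10] at h01'
    rw [h21] at h00'
    rw [h20, h00, h21] at h12'
    rw [h20, h10, h00, h21] at hdet
    have h11 : A 1 1 * d₁ = x₁ * v - d₂ := by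
      apply mul_right_cancel₀ hf'
      linear_combination -h02'
    have h22 : A 2 2 * d₂ = y₂ * v - y₃ * d₁ := by
      apply mul_right_cancel₀ hf'
      linear_combination v * h01' - d₁ * f * h00' - A 2 2 * h02'
    have h12 : A 1 2 * (d₁ * d₂) = x₁ * y₂ * v - (y₃ * x₁ * d₁ + y₂ * d₂) := by
      apply mul_right_cancel₀ hf'
      linear_combination x₁ * (f : ℤ) * h22 - d₂ * h01'
    have h01 : A 0 1 * (d₁ * f) = x₃ * v - u := by linear_combination -h12'
    refine ⟨⟨h00, h01, ?_⟩, ⟨h10, h11, h12⟩, h20, h21, h22⟩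
    -- `A₁₃` occurs in none of the four prescribed minors, so `det A = 1` is what determines it.
    linear_combination d₁ * hdet - A 0 2 * d₁ * h02' - d₁ * x₃ * h00' + A 0 1 * d₁ * h01'
      + y₂ * h01

end Coordinates

variable {d₁ d₂ : ℤ} {f : ℕ}

/-! ### Invariance of the stratum and integrality of its coordinates. -/

section Stratum

theorem mul_mem_stratum {A : SL(3, ℤ)} (hA : A ∈ stratum d₁ d₂ f) (k l m k' l' m' : ℤ) :
    unipotent k l m * A * unipotent k' l' m' ∈ stratum d₁ d₂ f := by
  obtain ⟨h1, h2, h3⟩ := hA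
  obtain ⟨e20, e10, -, -, e02, -⟩ := unipotent_translate A k l m k' l' m' rfl
  refine ⟨?_, e20.trans h2, e02.trans h3⟩
  rw [e20, e10, Int.gcd_add_mul_right_right, h1]

theorem Equivalent.mem_stratum {A B : SL(3, ℤ)} (h : Equivalent A B) (hB : B ∈ stratum d₁ d₂ f) :
    A ∈ stratum d₁ d₂ f := by
  obtain ⟨k, l, m, k', l', m', rfl⟩ := equivalent_iff_exists_unipotent.1 h
  exact mul_mem_stratum hB ..

theorem exists_hasCoords (hf : f ≠ 0) {A : SL(3, ℤ)} (hA : A ∈ stratum d₁ d₂ f) :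
    ∃ x₁ y₂ : ℤ, HasCoords A d₁ d₂ f x₁ y₂ (A 0 0)
        (delMinor (A : Matrix (Fin 3) (Fin 3) ℤ) 0 0)
        (delMinor (A : Matrix (Fin 3) (Fin 3) ℤ) 1 2) (A 2 1) ∧
      IsCoprime x₁ d₁ ∧ IsCoprime y₂ d₂ := by
  obtain ⟨h1, h2, h3⟩ := hA
  have h4 := gcd_column_eq_gcd_minors A
  rw [h1] at h4
  obtain ⟨x₁, hx⟩ : (f : ℤ) ∣ A 1 0 := h1 ▸ Int.gcd_dvd_right ..
  obtain ⟨y₂, hy⟩ : (f : ℤ) ∣ delMinor (A : Matrix (Fin 3) (Fin 3) ℤ) 0 1 :=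
    h4 ▸ Int.gcd_dvd_right ..
  rw [mul_comm] at hx hy
  refine ⟨x₁, y₂, ⟨h2, hx, rfl, rfl, h3, hy, rfl, rfl⟩, ?_, ?_⟩
  · rw [h2, hx, Int.gcd_mul_right, Int.natAbs_natCast] at h1
    exact (Int.isCoprime_iff_gcd_eq_one.2 (Nat.eq_of_mul_eq_mul_right (Nat.pos_of_ne_zero hf)
      (h1.trans (one_mul f).symm))).symm
  · rw [h3, hy, Int.gcd_mul_right, Int.natAbs_natCast] at h4
    exact (Int.isCoprime_iff_gcd_eq_one.2 (Nat.eq_of_mul_eq_mul_right (Nat.pos_of_ne_zero hf)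
      (h4.symm.trans (one_mul f).symm))).symm

theorem HasCoords.mem_stratum {A : SL(3, ℤ)} {x₁ y₂ x₃ y₃ u v : ℤ}
    (h : HasCoords A d₁ d₂ f x₁ y₂ x₃ y₃ u v) (hx : IsCoprime x₁ d₁) : A ∈ stratum d₁ d₂ f := by
  obtain ⟨h20, h10, -, -, h02, -⟩ := h
  refine ⟨?_, h20, h02⟩
  rw [h20, h10, Int.gcd_mul_right, Int.natAbs_natCast, Int.isCoprime_iff_gcd_eq_one.1 hx.symm,
    one_mul]

theorem HasCoords.isCoprime (hf : f ≠ 0) {A : SL(3, ℤ)} {x₁ y₂ x₃ y₃ u v : ℤ}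
    (h : HasCoords A d₁ d₂ f x₁ y₂ x₃ y₃ u v) (hA : A ∈ stratum d₁ d₂ f) :
    IsCoprime x₁ d₁ ∧ IsCoprime y₂ d₂ := by
  have hf' : (f : ℤ) ≠ 0 := by exact_mod_cast hf
  obtain ⟨x, y, h', hx, hy⟩ := exists_hasCoords hf hA
  have e1 : x₁ = x := mul_right_cancel₀ hf' (h.2.1.symm.trans h'.2.1)
  have e2 : y₂ = y := mul_right_cancel₀ hf'
    (h.2.2.2.2.2.1.symm.trans h'.2.2.2.2.2.1)
  exact ⟨e1 ▸ hx, e2 ▸ hy⟩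

theorem toReal_eq_of_hasCoords {A B : SL(3, ℤ)} (hd₁ : d₁ ≠ 0) (hd₂ : d₂ ≠ 0) (hf : f ≠ 0)
    {x₁ y₂ x₃ y₃ u v : ℤ} (hA : HasCoords A d₁ d₂ f x₁ y₂ x₃ y₃ u v)
    (hB : HasCoords B d₁ d₂ f x₁ y₂ x₃ y₃ u v) : A = B :=
  toReal_injective (((toReal_eq_coordMatrix_iff hd₁ hd₂ hf ..).2 hA).trans
    ((toReal_eq_coordMatrix_iff hd₁ hd₂ hf ..).2 hB).symm)

end Stratum

/-! ### Bruhat decomposition and the characters. -/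

section Bruhat

theorem IsUnipotent.det_eq_one {R : Type*} [CommRing R] {u : Matrix (Fin 3) (Fin 3) R}
    (hu : IsUnipotent u) : u.det = 1 := by
  obtain ⟨h1, h2, h3, h4, h5, h6⟩ := hu
  simp [Matrix.det_fin_three, h1, h2, h3, h4, h5, h6]

theorem IsUnipotent.blockTriangular {R : Type*} [CommRing R] {u : Matrix (Fin 3) (Fin 3) R}
    (hu : IsUnipotent u) : u.BlockTriangular id := by
  obtain ⟨h1, h2, h3, -⟩ := hu
  intro i j hij
  fin_cases i <;> fin_cases j <;> simp_all

theorem IsBruhat.mem_bigCell {A : SL(3, ℤ)} {c₁ c₂ : ℤ} (h₁ : c₁ ≠ 0) (h₂ : c₂ ≠ 0)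
    {uL uR : Matrix (Fin 3) (Fin 3) ℝ} (h : IsBruhat A c₁ c₂ uL uR) : A ∈ bigCell := by
  obtain ⟨hL, hR, hA⟩ := h
  have h₁' : (c₁ : ℝ) ≠ 0 := by exact_mod_cast h₁
  have h₂' : (c₂ : ℝ) ≠ 0 := by exact_mod_cast h₂
  have ht : (torus c₁ c₂).det = 1 := by
    simp [torus, Fin.prod_univ_three]
    field_simp
  refine ⟨⟨uL, hL.det_eq_one⟩, ⟨torus c₁ c₂ * uR, ?_⟩, hL.blockTriangular, ?_, ?_⟩
  · rw [Matrix.det_mul, ht, hR.det_eq_one, one_mul]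
  · exact (Matrix.blockTriangular_diagonal _).mul hR.blockTriangular
  · rw [hA, Matrix.mul_assoc _ (torus _ _)]

theorem isBruhat_of_toReal_eq_coordMatrix {A : SL(3, ℤ)} {x₁ y₂ x₃ y₃ u v : ℤ}
    (h : toReal A = coordMatrix d₁ d₂ f x₁ y₂ x₃ y₃ u v) :
    ∃ uL uR, IsBruhat A (d₁ * f) (d₂ * f) uL uR := by
  refine ⟨!![1, (u : ℝ) / (d₂ * f), (x₃ : ℝ) / (d₁ * f); 0, 1, (x₁ : ℝ) / d₁; 0, 0, 1],
    !![1, (v : ℝ) / (d₁ * f), ((y₂ : ℝ) * v - y₃ * d₁) / (d₁ * d₂ * f);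
      0, 1, (y₂ : ℝ) / d₂; 0, 0, 1], ?_, ?_, ?_⟩
  · simp [IsUnipotent]
  · simp [IsUnipotent]
  · rw [h, coordMatrix]
    push_cast
    rfl

theorem stratum_subset (hd₁ : d₁ ≠ 0) (hd₂ : d₂ ≠ 0) (hf : f ≠ 0) :
    stratum d₁ d₂ f ⊆ bigCell ∩ coarseSet (d₁ * f) (d₂ * f) := by
  intro A hA
  have hf' : (f : ℤ) ≠ 0 := by exact_mod_cast hf
  obtain ⟨x₁, y₂, h, -⟩ := exists_hasCoords hf hA
  obtain ⟨uL, uR, hB⟩ :=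
    isBruhat_of_toReal_eq_coordMatrix ((toReal_eq_coordMatrix_iff hd₁ hd₂ hf ..).2 h)
  exact ⟨hB.mem_bigCell (mul_ne_zero hd₁ hf') (mul_ne_zero hd₂ hf'), uL, uR, hB⟩

/-- The exponent of `ψ_m(u_L) ψ_n(u_R)` for `A = u_L w₀ t(c₁, c₂) u_R`. -/
noncomputable def phase (m n : Fin 2 → ℤ) (c₁ c₂ : ℤ) (A : SL(3, ℤ)) : ℝ :=
  m 0 * delMinor (A : Matrix (Fin 3) (Fin 3) ℤ) 1 2 / c₂ + m 1 * A 1 0 / c₁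
    + (n 0 * A 2 1 / c₁ + n 1 * delMinor (A : Matrix (Fin 3) (Fin 3) ℤ) 0 1 / c₂)

theorem expo_add (x y : ℝ) : expo (x + y) = expo x * expo y := by
  rw [expo, expo, expo, ← Complex.exp_add]
  congr 1
  push_cast
  ring

theorem expo_intCast (k : ℤ) : expo k = 1 := by
  rw [expo, ← Complex.exp_int_mul_two_pi_mul_I k]
  congr 1
  push_cast
  ring

theorem expo_eq_of_sub_eq_intCast {x y : ℝ} (k : ℤ) (h : x - y = k) : expo x = expo y := by
  rw [← sub_add_cancel x y, h, expo_add, expo_intCast, one_mul]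

/-- The superdiagonal entries of `u_L` are `M₂₃/c₂` and `A₂₁/c₁`, those of `u_R` are `A₃₂/c₁` and
`M₁₂/c₂`. The value thus depends on `A` alone, and the choice made in `kloostermanTerm` is harmless.
-/
theorem IsBruhat.psi_mul_psi {A : SL(3, ℤ)} {c₁ c₂ : ℤ} (h₁ : c₁ ≠ 0) (h₂ : c₂ ≠ 0)
    {uL uR : Matrix (Fin 3) (Fin 3) ℝ} (h : IsBruhat A c₁ c₂ uL uR) (m n : Fin 2 → ℤ) :
    psi m uL * psi n uR = expo (phase m n c₁ c₂ A) := by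
  obtain ⟨⟨l1, l2, l3, l4, l5, l6⟩, ⟨r1, r2, r3, r4, r5, r6⟩, hA⟩ := h
  have h₁' : (c₁ : ℝ) ≠ 0 := by exact_mod_cast h₁
  have h₂' : (c₂ : ℝ) ≠ 0 := by exact_mod_cast h₂
  have key : ∀ i j, (A i j : ℝ) = (uL * wLong * torus c₁ c₂ * uR) i j := fun i j =>
    congrFun (congrFun hA i) j
  rw [psi, psi, ← expo_add, phase, delMinor_one_two, delMinor_zero_one]
  push_cast
  simp only [key]
  congr 1
  simp [torus_eq, wLong, Matrix.mul_apply, Fin.sum_univ_three, l1, l2, l3, l4, l5, l6,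
    r1, r2, r3, r4, r5, r6]
  field_simp
  ring

/-- A translation moves each of the four numerators in `phase` by an integral multiple of its
denominator. -/
theorem Equivalent.expo_phase_eq (hd₁ : d₁ ≠ 0) (hd₂ : d₂ ≠ 0) (hf : f ≠ 0) {A B : SL(3, ℤ)}
    (h : Equivalent A B) (hB : B ∈ stratum d₁ d₂ f) (m n : Fin 2 → ℤ) :
    expo (phase m n (d₁ * f) (d₂ * f) A) = expo (phase m n (d₁ * f) (d₂ * f) B) := by
  have h1 : (d₁ : ℝ) ≠ 0 := by exact_mod_cast hd₁
  have h2 : (d₂ : ℝ) ≠ 0 := by exact_mod_cast hd₂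
  have h3 : (f : ℝ) ≠ 0 := by exact_mod_cast hf
  obtain ⟨k, l, r, k', l', r', hAB⟩ := equivalent_iff_exists_unipotent.1 h
  obtain ⟨-, e10, -, e21, -, e01, -, e12⟩ := unipotent_translate B k l r k' l' r' hAB
  apply expo_eq_of_sub_eq_intCast (m 0 * k + m 1 * r + n 0 * k' + n 1 * r')
  rw [phase, phase, e10, e21, e01, e12, hB.2.1, hB.2.2]
  push_cast
  field_simp
  ring

theorem kloostermanTerm_eq (hd₁ : d₁ ≠ 0) (hd₂ : d₂ ≠ 0) (hf : f ≠ 0) {A : SL(3, ℤ)}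
    (hA : A ∈ stratum d₁ d₂ f) (m n : Fin 2 → ℤ) :
    kloostermanTerm m n (d₁ * f) (d₂ * f) A = expo (phase m n (d₁ * f) (d₂ * f) A) := by
  have hf' : (f : ℤ) ≠ 0 := by exact_mod_cast hf
  have h : ∃ p : Matrix (Fin 3) (Fin 3) ℝ × Matrix (Fin 3) (Fin 3) ℝ,
      IsBruhat A (d₁ * f) (d₂ * f) p.1 p.2 := by
    obtain ⟨uL, uR, h⟩ := (stratum_subset hd₁ hd₂ hf hA).2
    exact ⟨(uL, uR), h⟩
  rw [kloostermanTerm, dif_pos h]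
  exact h.choose_spec.psi_mul_psi (mul_ne_zero hd₁ hf') (mul_ne_zero hd₂ hf') m n

end Bruhat

/-! ### Classification of double cosets by coordinates. -/

section Representatives

theorem exists_equivalent_ne_zero (hd₁ : d₁ ≠ 0) (hf : f ≠ 0) {A : SL(3, ℤ)}
    (hA : A ∈ stratum d₁ d₂ f) :
    ∃ A' : SL(3, ℤ), Equivalent A' A ∧
      A' 0 0 * delMinor (A' : Matrix (Fin 3) (Fin 3) ℤ) 0 0 - 1 ≠ 0 := by
  have hf' : (f : ℤ) ≠ 0 := by exact_mod_cast hf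
  by_cases h : A 0 0 * delMinor (A : Matrix (Fin 3) (Fin 3) ℤ) 0 0 - 1 = 0
  -- Adding the third row to the first changes `A₁₁` by `d₁f ≠ 0` and keeps `M₁₁`, which is nonzero
  -- because `A₁₁M₁₁ = 1`.
  · obtain ⟨-, -, e00, -, -, -, m00, -⟩ := unipotent_translate A 0 1 0 0 0 0 rfl
    refine ⟨_, equivalent_iff_exists_unipotent.2 ⟨0, 1, 0, 0, 0, 0, rfl⟩, ?_⟩
    rw [e00, m00, hA.2.1]
    intro h'
    have h0 : d₁ * f * delMinor (A : Matrix (Fin 3) (Fin 3) ℤ) 0 0 = 0 := by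
      linear_combination h' - h
    rcases mul_eq_zero.1 h0 with h0 | h0
    · exact mul_ne_zero hd₁ hf' h0
    · rw [h0] at h
      simp at h
  · exact ⟨A, Equivalent.refl A, h⟩

theorem exists_equivalent_corner_iff {A : SL(3, ℤ)} (hA : A ∈ stratum d₁ d₂ f) (x₃ y₃ : ℤ) :
    (∃ A' : SL(3, ℤ), Equivalent A' A ∧ A' 0 0 = x₃ ∧
        delMinor (A' : Matrix (Fin 3) (Fin 3) ℤ) 0 0 = y₃) ↔
      x₃ ≡ A 0 0 [ZMOD f] ∧ y₃ ≡ delMinor (A : Matrix (Fin 3) (Fin 3) ℤ) 0 0 [ZMOD f] := by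
  have hg := hA.1
  have hg' := hg
  rw [gcd_column_eq_gcd_minors] at hg'
  have a1 : (f : ℤ) ∣ A 2 0 := hg ▸ Int.gcd_dvd_left ..
  have a2 : (f : ℤ) ∣ A 1 0 := hg ▸ Int.gcd_dvd_right ..
  have b1 : (f : ℤ) ∣ delMinor (A : Matrix (Fin 3) (Fin 3) ℤ) 0 2 := hg' ▸ Int.gcd_dvd_left ..
  have b2 : (f : ℤ) ∣ delMinor (A : Matrix (Fin 3) (Fin 3) ℤ) 0 1 := hg' ▸ Int.gcd_dvd_right ..
  constructor
  · rintro ⟨A', h, rfl, rfl⟩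
    obtain ⟨k, l, r, k', l', r', hAB⟩ := equivalent_iff_exists_unipotent.1 h
    obtain ⟨-, -, e00, -, -, -, m00, -⟩ := unipotent_translate A k l r k' l' r' hAB
    constructor
    · apply Int.ModEq.symm
      rw [Int.modEq_iff_dvd, e00, add_assoc, add_sub_cancel_left]
      exact dvd_add (a2.mul_left _) (a1.mul_left _)
    · apply Int.ModEq.symm
      rw [Int.modEq_iff_dvd, m00, add_assoc, add_sub_cancel_left]
      exact dvd_add (b2.mul_left _) (b1.mul_left _)
  · rintro ⟨hx, hy⟩
    obtain ⟨s, hs⟩ := Int.modEq_iff_dvd.1 hx.symm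
    obtain ⟨t, ht⟩ := Int.modEq_iff_dvd.1 hy.symm
    -- Bézout for the first column and for the minors `M₁₃, M₁₂`: row operations then shift `A₁₁`,
    -- and column operations shift `M₁₁`, by any multiple of `f`.
    obtain ⟨a, b, hab⟩ : ∃ a b : ℤ, (f : ℤ) = A 2 0 * a + A 1 0 * b :=
      ⟨_, _, by rw [← hg, Int.gcd_eq_gcd_ab]⟩
    obtain ⟨c, d, hcd⟩ : ∃ c d : ℤ, (f : ℤ) = delMinor (A : Matrix (Fin 3) (Fin 3) ℤ) 0 2 * c
        + delMinor (A : Matrix (Fin 3) (Fin 3) ℤ) 0 1 * d :=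
      ⟨_, _, by rw [← hg', Int.gcd_eq_gcd_ab]⟩
    obtain ⟨-, -, e00, -, -, -, m00, -⟩ :=
      unipotent_translate A (s * b) (s * a) 0 (t * d) (-(t * c)) 0 rfl
    refine ⟨_, equivalent_iff_exists_unipotent.2
      ⟨s * b, s * a, 0, t * d, -(t * c), 0, rfl⟩, ?_, ?_⟩
    · rw [e00]
      linear_combination -hs - s * hab
    · rw [m00]
      linear_combination -ht - t * hcd

/-- For fixed corner entry `x₃` and corner minor `y₃`, the coordinates `u`, `x₁`, `y₂` determine
`v` modulo `d₁ d₂ f`. -/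
theorem v_modEq (hf : f ≠ 0) {A B : SL(3, ℤ)} {x₃ y₃ x₁ y₂ u v X₁ Y₂ U V : ℤ}
    (hA : HasCoords A d₁ d₂ f x₁ y₂ x₃ y₃ u v) (hB : HasCoords B d₁ d₂ f X₁ Y₂ x₃ y₃ U V)
    (hx : IsCoprime x₁ d₁) (hu : u ≡ U [ZMOD (d₁ * d₂ * f)]) (hxX : x₁ ≡ X₁ [ZMOD d₁]) :
    v ≡ V [ZMOD (d₁ * d₂ * f)] := by
  have hf' : (f : ℤ) ≠ 0 := by exact_mod_cast hf
  -- With `p = M₂₁` and `e = M₃₁`: the first identity expresses an entry as a minor of the cofactor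
  -- matrix, the second expands `det A` along the first column. As `x₃y₃` is common to both
  -- matrices, `x₁p ≡ X₁P` modulo `d₁`, hence `p ≡ P`, and `v` is controlled by `u` and `p`.
  have aux : ∀ {A : SL(3, ℤ)} {x₁ y₂ u v : ℤ}, HasCoords A d₁ d₂ f x₁ y₂ x₃ y₃ u v →
      v = y₃ * u - d₂ * f * delMinor (A : Matrix (Fin 3) (Fin 3) ℤ) 1 0 ∧
      ∃ e, f * (x₁ * delMinor (A : Matrix (Fin 3) (Fin 3) ℤ) 1 0 - d₁ * e) = x₃ * y₃ - 1 := by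
    intro A x₁ y₂ u v h
    obtain ⟨h20, h10, h00, h21, m02, m01, m00, m12⟩ := h
    have hdet := det_expand A
    rw [delMinor_zero_two] at m02
    rw [delMinor_zero_zero] at m00
    rw [delMinor_one_two] at m12
    rw [delMinor_one_zero]
    constructor
    · rw [← m12, ← m02, ← m00, ← h21]
      linear_combination (-A 2 1) * hdet
    · refine ⟨A 0 1 * A 1 2 - A 0 2 * A 1 1, ?_⟩
      rw [← m00, ← h00]
      linear_combination (-(A 0 1 * A 2 2 - A 0 2 * A 2 1)) * h10
        + (A 0 1 * A 1 2 - A 0 2 * A 1 1) * h20 - hdet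
  obtain ⟨hv, e, he⟩ := aux hA
  obtain ⟨hV, E, hE⟩ := aux hB
  set p := delMinor (A : Matrix (Fin 3) (Fin 3) ℤ) 1 0
  set P := delMinor (B : Matrix (Fin 3) (Fin 3) ℤ) 1 0
  have hpe : x₁ * p - d₁ * e = X₁ * P - d₁ * E := mul_left_cancel₀ hf' (he.trans hE.symm)
  obtain ⟨s, hs⟩ := Int.modEq_iff_dvd.1 hxX
  have hdvd : d₁ ∣ x₁ * (P - p) :=
    ⟨E - e - s * P, by linear_combination -hpe - P * hs⟩
  obtain ⟨t, ht⟩ := hx.symm.dvd_of_dvd_mul_left hdvd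
  obtain ⟨r, hr⟩ := Int.modEq_iff_dvd.1 hu
  rw [Int.modEq_iff_dvd]
  refine ⟨y₃ * r - t, ?_⟩
  rw [hv, hV]
  linear_combination y₃ * hr - d₂ * f * ht

theorem equivalent_iff_of_hasCoords (hd₁ : d₁ ≠ 0) (hd₂ : d₂ ≠ 0) (hf : f ≠ 0) {A B : SL(3, ℤ)}
    {x₃ y₃ x₁ y₂ u v X₁ Y₂ U V : ℤ} (hAs : A ∈ stratum d₁ d₂ f)
    (hA : HasCoords A d₁ d₂ f x₁ y₂ x₃ y₃ u v) (hB : HasCoords B d₁ d₂ f X₁ Y₂ x₃ y₃ U V) :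
    Equivalent A B ↔
      u ≡ U [ZMOD (d₁ * d₂ * f)] ∧ x₁ ≡ X₁ [ZMOD d₁] ∧ y₂ ≡ Y₂ [ZMOD d₂] := by
  have hf' : (f : ℤ) ≠ 0 := by exact_mod_cast hf
  obtain ⟨hx, hy⟩ := hA.isCoprime hf hAs
  constructor
  · intro h
    have hX := (hB.isCoprime hf (h.symm.mem_stratum hAs)).1
    obtain ⟨a20, a10, a00, a21, a02, a01, am00, a12⟩ := hA
    obtain ⟨b20, b10, b00, b21, b02, b01, bm00, b12⟩ := hB
    obtain ⟨k, l, r, k', l', r', hAB⟩ := equivalent_iff_exists_unipotent.1 h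
    obtain ⟨-, e10, e00, -, -, e01, -, e12⟩ := unipotent_translate B k l r k' l' r' hAB
    rw [a10, b10, b20] at e10
    rw [a00, b00, b10, b20] at e00
    rw [a01, b01, b02] at e01
    rw [a12, b12, b02] at e12
    -- Equality of the two corners `x₃` says `kX₁ + ld₁ = 0`.
    have hk : d₁ ∣ k * X₁ := ⟨-l, mul_right_cancel₀ hf' (by linear_combination -e00)⟩
    obtain ⟨s, hs⟩ := hX.symm.dvd_of_dvd_mul_right hk
    refine ⟨Int.ModEq.symm (Int.modEq_iff_dvd.2 ⟨s, ?_⟩),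
      Int.ModEq.symm (Int.modEq_iff_dvd.2 ⟨r, mul_right_cancel₀ hf' ?_⟩),
      Int.ModEq.symm (Int.modEq_iff_dvd.2 ⟨r', mul_right_cancel₀ hf' ?_⟩)⟩
    · linear_combination e12 + d₂ * f * hs
    · linear_combination e10
    · linear_combination e01
  · rintro ⟨hu, hxX, hyY⟩
    have hv := v_modEq hf hA hB hx hu hxX
    obtain ⟨s, hs⟩ := Int.modEq_iff_dvd.1 hu.symm
    obtain ⟨t, ht⟩ := Int.modEq_iff_dvd.1 hv.symm
    obtain ⟨r, hr⟩ := Int.modEq_iff_dvd.1 hxX.symm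
    obtain ⟨r', hr'⟩ := Int.modEq_iff_dvd.1 hyY.symm
    obtain ⟨b20, b10, b00, b21, b02, b01, bm00, b12⟩ := hB
    -- `k = sd₁` corrects `u`, and `l = -sX₁` cancels its effect on `x₃`. Likewise `k' = td₂`
    -- corrects `v`, and `l' = ty₂` keeps `y₃`; here `y₂`, not `Y₂`, enters because `m' = r'` has
    -- already moved `Y₂` to `y₂`.
    obtain ⟨e20, e10, e00, e21, e02, e01, em00, e12⟩ := unipotent_translate B
      (s * d₁) (-(s * X₁)) r (t * d₂) (t * y₂) r' rfl
    refine equivalent_iff_exists_unipotent.2 ⟨s * d₁, -(s * X₁), r, t * d₂, t * y₂, r',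
      toReal_eq_of_hasCoords hd₁ hd₂ hf hA ⟨e20.trans b20, ?_, ?_, ?_, e02.trans b02, ?_, ?_, ?_⟩⟩
    · rw [e10, b10, b20]
      linear_combination -f * hr
    · rw [e00, b00, b10, b20]
      ring
    · rw [e21, b21, b20]
      linear_combination -ht
    · rw [e01, b01, b02]
      linear_combination -f * hr'
    · rw [em00, bm00, b01, b02]
      linear_combination (-t * d₂ * f) * hr'
    · rw [e12, b12, b02]
      linear_combination -hs

end Representatives

/-! ### Integrality of the coordinate matrix. -/

section Integrality

theorem det_coordMatrix (hd₁ : d₁ ≠ 0) (hd₂ : d₂ ≠ 0) (hf : f ≠ 0) (x₁ y₂ x₃ y₃ u v : ℤ) :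
    (coordMatrix d₁ d₂ f x₁ y₂ x₃ y₃ u v).det = 1 := by
  have h1 : (d₁ : ℝ) ≠ 0 := by exact_mod_cast hd₁
  have h2 : (d₂ : ℝ) ≠ 0 := by exact_mod_cast hd₂
  have h3 : (f : ℝ) ≠ 0 := by exact_mod_cast hf
  simp only [coordMatrix, Matrix.det_mul]
  simp [Matrix.det_fin_three, wLong, torus_eq]
  field_simp

/-- The last five congruences say that the five fractional entries of `(*)` are integers. The
determinant is automatically one, and its expansion along the first row gives `x₃y₃ ≡ 1`. -/
theorem exists_toReal_eq_coordMatrix_iff (hd₁ : d₁ ≠ 0) (hd₂ : d₂ ≠ 0) (hf : f ≠ 0)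
    (x₁ y₂ x₃ y₃ u v : ℤ) :
    (∃ A ∈ bigCell, toReal A = coordMatrix d₁ d₂ f x₁ y₂ x₃ y₃ u v) ↔
      x₃ * y₃ ≡ 1 [ZMOD f] ∧
      x₁ * v ≡ d₂ [ZMOD d₁] ∧
      y₂ * v ≡ y₃ * d₁ [ZMOD d₂] ∧
      x₃ * v ≡ u [ZMOD (d₁ * f)] ∧
      x₁ * y₂ * v ≡ y₃ * x₁ * d₁ + y₂ * d₂ [ZMOD (d₁ * d₂)] ∧
      x₃ * y₂ * v + d₁ * (1 - x₃ * y₃) ≡ u * y₂ [ZMOD (d₁ * d₂ * f)] := by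
  have hf' : (f : ℤ) ≠ 0 := by exact_mod_cast hf
  have modEq {a b n c : ℤ} (h : c * n = a - b) : a ≡ b [ZMOD n] :=
    Int.ModEq.symm (Int.modEq_iff_dvd.2 ⟨c, by rw [← h, mul_comm]⟩)
  constructor
  · rintro ⟨A, -, hA⟩
    obtain ⟨⟨-, h01, h02⟩, ⟨-, h11, h12⟩, -, -, h22⟩ :=
      (toReal_eq_coordMatrix_iff_entries hd₁ hd₂ hf _ ..).1 hA
    obtain ⟨-, -, h00, -, m02, m01, m00, -⟩ := (toReal_eq_coordMatrix_iff hd₁ hd₂ hf ..).1 hA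
    refine ⟨?_, modEq h11, modEq h22, modEq h01, modEq h12, modEq h02⟩
    have hdet := det_expand A
    rw [delMinor_zero_two] at m02
    rw [delMinor_zero_one] at m01
    rw [delMinor_zero_zero] at m00
    apply modEq (c := A 0 1 * y₂ - A 0 2 * d₂)
    rw [← h00, ← m00]
    linear_combination -A 0 1 * m01 + A 0 2 * m02 - hdet
  · rintro ⟨-, h11, h22, h01, h12, h02⟩
    obtain ⟨a11, h11⟩ := Int.modEq_iff_dvd.1 h11.symm
    obtain ⟨a22, h22⟩ := Int.modEq_iff_dvd.1 h22.symm
    obtain ⟨a01, h01⟩ := Int.modEq_iff_dvd.1 h01.symm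
    obtain ⟨a12, h12⟩ := Int.modEq_iff_dvd.1 h12.symm
    obtain ⟨a02, h02⟩ := Int.modEq_iff_dvd.1 h02.symm
    have hM := (toReal_eq_coordMatrix_iff_entries hd₁ hd₂ hf
      !![x₃, a01, a02; x₁ * f, a11, a12; d₁ * f, v, a22] x₁ y₂ x₃ y₃ u v).2
      ⟨⟨rfl, (mul_comm _ _).trans h01.symm, (mul_comm _ _).trans h02.symm⟩,
        ⟨rfl, (mul_comm _ _).trans h11.symm, (mul_comm _ _).trans h12.symm⟩,
        rfl, rfl, (mul_comm _ _).trans h22.symm⟩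
    have hdet : (!![x₃, a01, a02; x₁ * f, a11, a12; d₁ * f, v, a22] :
        Matrix (Fin 3) (Fin 3) ℤ).det = 1 := by
      apply Int.cast_injective (α := ℝ)
      rw [Int.cast_det, hM, det_coordMatrix hd₁ hd₂ hf, Int.cast_one]
    have hA : toReal ⟨_, hdet⟩ = coordMatrix d₁ d₂ f x₁ y₂ x₃ y₃ u v := hM
    obtain ⟨uL, uR, hB⟩ := isBruhat_of_toReal_eq_coordMatrix hA
    exact ⟨_, hB.mem_bigCell (mul_ne_zero hd₁ hf') (mul_ne_zero hd₂ hf'), hA⟩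

end Integrality

/-! ### Factorization into embedded `2 × 2` blocks. -/

section Factorization

theorem eBeta_mul_sBeta_mul_hBeta_mul_eBeta {d : ℝ} (hd : d ≠ 0) (x y : ℝ) :
    eBeta (x / d) * sBeta * hBeta d * eBeta (y / d) =
      iotaBeta !![x, (x * y - 1) / d; d, y] := by
  ext i j
  fin_cases i <;> fin_cases j <;>
    simp [eBeta, sBeta, hBeta, iotaBeta, Matrix.mul_apply, Fin.sum_univ_three]
  all_goals field_simp
  all_goals ring

theorem eAlpha_mul_sAlpha_mul_hAlpha_mul_eAlpha {d : ℝ} (hd : d ≠ 0) (x y : ℝ) :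
    eAlpha (x / d) * sAlpha * hAlpha d * eAlpha (y / d) =
      iotaAlpha !![x, (x * y - 1) / d; d, y] := by
  ext i j
  fin_cases i <;> fin_cases j <;>
    simp [eAlpha, sAlpha, hAlpha, iotaAlpha, Matrix.mul_apply, Fin.sum_univ_three]
  all_goals field_simp
  all_goals ring

theorem iotaBeta_mul_iotaAlpha_mul_iotaBeta (a b c d a' b' c' d' p q r s : ℝ) :
    iotaBeta !![a, b; c, d] * iotaAlpha !![p, q; r, s] * iotaBeta !![a', b'; c', d'] =
      !![p, q * a', q * b';
        a * r, a * s * a' + b * c', a * s * b' + b * d';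
        c * r, c * s * a' + d * c', c * s * b' + d * d'] := by
  ext i j
  fin_cases i <;> fin_cases j <;>
    simp [iotaBeta, iotaAlpha, Matrix.mul_apply, Fin.sum_univ_three]

end Factorization

section Factorization

theorem delMinor_toReal (A : SL(3, ℤ)) (i j : Fin 3) :
    delMinor (toReal A) i j = ((delMinor (A : Matrix (Fin 3) (Fin 3) ℤ) i j : ℤ) : ℝ) := by
  rw [delMinor, delMinor, Int.cast_det]
  rfl

/-- Comparing entries with the product of the three blocks leaves relations that follow from `det A
= 1` after cancelling `f` or `d₂`; division by `D` turns `A₁₂` and `M₂₁` into `x₂` and `y₁`. -/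
theorem HasCoords.toReal_eq_iota_mul (hd₁ : d₁ ≠ 0) (hd₂ : d₂ ≠ 0) (hf : f ≠ 0) {A : SL(3, ℤ)}
    {x₁ y₂ x₃ y₃ u v D : ℤ} (h : HasCoords A d₁ d₂ f x₁ y₂ x₃ y₃ u v) (hD : D ≠ 0)
    (hfD : f * D = x₃ * y₃ - 1) {x₂ y₁ : ℝ} (hx₂ : x₂ = A 0 1 / D)
    (hy₁ : y₁ = delMinor (A : Matrix (Fin 3) (Fin 3) ℤ) 1 0 / D) :
    (u : ℝ) = x₂ * d₁ + x₃ * d₂ * y₁ ∧ (v : ℝ) = x₂ * d₁ * y₃ + d₂ * y₁ ∧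
    toReal A =
      iotaBeta !![(x₁ : ℝ), (x₁ * y₁ - 1) / d₁; (d₁ : ℝ), y₁] *
      iotaAlpha !![(x₃ : ℝ), (D : ℝ); (f : ℝ), (y₃ : ℝ)] *
      iotaBeta !![x₂, (x₂ * y₂ - 1) / d₂; (d₂ : ℝ), (y₂ : ℝ)] := by
  have hf' : (f : ℤ) ≠ 0 := by exact_mod_cast hf
  have r1 : (d₁ : ℝ) ≠ 0 := by exact_mod_cast hd₁
  have r2 : (d₂ : ℝ) ≠ 0 := by exact_mod_cast hd₂
  have rD : (D : ℝ) ≠ 0 := by exact_mod_cast hD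
  obtain ⟨⟨-, h01, h02⟩, ⟨-, h11, h12⟩, -, -, h22⟩ :=
    (toReal_eq_coordMatrix_iff_entries hd₁ hd₂ hf _ ..).1
      ((toReal_eq_coordMatrix_iff hd₁ hd₂ hf ..).2 h)
  obtain ⟨h20, h10, h00, h21, m02, m01, m00, m12⟩ := h
  have hdet := det_expand A
  set M := delMinor (A : Matrix (Fin 3) (Fin 3) ℤ) 1 0 with hM
  rw [delMinor_one_zero] at hM
  rw [delMinor_zero_two] at m02
  rw [delMinor_zero_one] at m01
  rw [delMinor_zero_zero] at m00
  have e21 : D * v = y₃ * d₁ * A 0 1 + d₂ * M := by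
    apply mul_left_cancel₀ hf'
    rw [← h21]
    linear_combination A 2 1 * hfD + M * m02 + A 2 1 * hdet - A 2 1 * y₃ * h00
      - (A 2 1 * A 0 0 - A 0 1 * A 2 0) * m00 + y₃ * A 0 1 * h20
      - (A 1 0 * A 2 1 - A 1 1 * A 2 0) * hM
  -- This is the expansion of `det A` along the first row, divided by `f`.
  have e02 : A 0 2 * d₂ = A 0 1 * y₂ - D := by
    apply mul_left_cancel₀ hf'
    linear_combination hdet - A 0 0 * m00 - A 0 2 * m02 + A 0 1 * m01 + hfD - y₃ * h00
  have e22 : D * A 2 2 = y₃ * d₁ * A 0 2 + M * y₂ := by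
    apply mul_right_cancel₀ hd₂
    linear_combination D * h22 + y₂ * e21 - y₃ * d₁ * e02
  have c21 : (D : ℝ) * v = y₃ * d₁ * A 0 1 + d₂ * M := by exact_mod_cast e21
  have c02 : (A 0 2 : ℝ) * d₂ = A 0 1 * y₂ - D := by exact_mod_cast e02
  have c22 : (D : ℝ) * A 2 2 = y₃ * d₁ * A 0 2 + M * y₂ := by exact_mod_cast e22
  have c01 : (A 0 1 : ℝ) * (d₁ * f) = x₃ * v - u := by exact_mod_cast h01
  have c11 : (A 1 1 : ℝ) * d₁ = x₁ * v - d₂ := by exact_mod_cast h11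
  have c12 : (A 1 2 : ℝ) * d₁ = x₁ * A 2 2 - y₂ := by
    have : A 1 2 * d₁ = x₁ * A 2 2 - y₂ := by
      apply mul_right_cancel₀ hd₂
      linear_combination h12 - x₁ * h22
    exact_mod_cast this
  have cfD : (f : ℝ) * D = x₃ * y₃ - 1 := by exact_mod_cast hfD
  have k02 : (A 0 2 : ℝ) = D * ((x₂ * y₂ - 1) / d₂) := by
    rw [hx₂]
    field_simp
    linear_combination c02
  have k21 : (v : ℝ) = d₁ * y₃ * x₂ + y₁ * d₂ := by
    rw [hx₂, hy₁]
    field_simp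
    linear_combination c21
  have k22 : (A 2 2 : ℝ) = d₁ * y₃ * ((x₂ * y₂ - 1) / d₂) + y₁ * y₂ := by
    apply mul_left_cancel₀ rD
    rw [c22, k02, hy₁]
    field_simp
  refine ⟨?_, by rw [k21]; ring, ?_⟩
  · rw [hx₂, hy₁]
    field_simp
    linear_combination x₃ * c21 + D * c01 - A 0 1 * d₁ * cfD
  · rw [iotaBeta_mul_iotaAlpha_mul_iotaBeta]
    ext i j
    rw [toReal_apply]
    fin_cases i <;> fin_cases j <;> simp
    · exact_mod_cast h00
    · rw [hx₂]
      field_simp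
    · exact k02
    · exact_mod_cast h10
    · apply mul_right_cancel₀ r1
      rw [c11, k21]
      field_simp
      ring
    · apply mul_right_cancel₀ r1
      rw [c12, k22]
      field_simp
      ring
    · exact_mod_cast h20
    · rw [h21, k21]
    · exact k22

end Factorization

/-! ### Residues, inverse pairs and orthogonality of characters. -/

section Residues

theorem exists_nat_modEq {c : ℤ} (hc : c ≠ 0) (a : ℤ) :
    ∃ n : ℕ, n < c.natAbs ∧ (n : ℤ) ≡ a [ZMOD c] := by
  have h : ((a % c).toNat : ℤ) = a % c := Int.toNat_of_nonneg (Int.emod_nonneg a hc)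
  refine ⟨(a % c).toNat, ?_, ?_⟩
  · have := Int.emod_lt_abs a hc
    rw [Int.abs_eq_natAbs] at this
    omega
  · rw [h]
    exact Int.mod_modEq a c

theorem nat_eq_of_modEq {c : ℤ} {a b : ℕ} (ha : a < c.natAbs) (hb : b < c.natAbs)
    (h : (a : ℤ) ≡ b [ZMOD c]) : a = b := by
  have := Int.eq_zero_of_abs_lt_dvd ((Int.natAbs_dvd).2 (Int.modEq_iff_dvd.1 h))
    (abs_lt.2 ⟨by omega, by omega⟩)
  omega

theorem modEq_of_mul_modEq_one {c x x' y y' : ℤ} (hx : x ≡ x' [ZMOD c]) (h : x * y ≡ 1 [ZMOD c])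
    (h' : x' * y' ≡ 1 [ZMOD c]) : y ≡ y' [ZMOD c] :=
  calc y = y * 1 := (mul_one y).symm
    _ ≡ y * (x' * y') [ZMOD c] := h'.symm.mul_left y
    _ ≡ y * (x * y') [ZMOD c] := (hx.symm.mul_right y').mul_left y
    _ = x * y * y' := by ring
    _ ≡ 1 * y' [ZMOD c] := h.mul_right y'
    _ = y' := one_mul y'

theorem isCoprime_of_mul_modEq_one {c x y : ℤ} (h : x * y ≡ 1 [ZMOD c]) : IsCoprime x c := by
  obtain ⟨k, hk⟩ := Int.modEq_iff_dvd.1 h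
  exact ⟨y, k, by linear_combination -hk⟩

/-- Pairs of mutually inverse residues modulo `c`. -/
def inversePairs (c : ℤ) : Finset (ℕ × ℕ) :=
  (Finset.range c.natAbs ×ˢ Finset.range c.natAbs).filter
    (fun p : ℕ × ℕ => (p.1 : ℤ) * p.2 ≡ 1 [ZMOD c])

theorem mem_inversePairs {c : ℤ} {p : ℕ × ℕ} :
    p ∈ inversePairs c ↔
      (p.1 < c.natAbs ∧ p.2 < c.natAbs) ∧ (p.1 : ℤ) * p.2 ≡ 1 [ZMOD c] := by
  simp [inversePairs]

theorem exists_inversePair {c : ℤ} (hc : c ≠ 0) {x : ℤ} (hx : IsCoprime x c) :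
    ∃ p ∈ inversePairs c, (p.1 : ℤ) ≡ x [ZMOD c] := by
  obtain ⟨a, b, hab⟩ := hx
  obtain ⟨n, hn, hnx⟩ := exists_nat_modEq hc x
  obtain ⟨k, hk, hka⟩ := exists_nat_modEq hc a
  refine ⟨(n, k), mem_inversePairs.2 ⟨⟨hn, hk⟩, (hnx.mul hka).trans ?_⟩, hnx⟩
  exact Int.modEq_iff_dvd.2 ⟨b, by linear_combination -hab⟩

theorem swap_mem_inversePairs {c : ℤ} {p : ℕ × ℕ} (hp : p ∈ inversePairs c) :
    p.swap ∈ inversePairs c := by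
  rw [mem_inversePairs] at hp ⊢
  exact ⟨hp.1.symm, by simpa [mul_comm] using hp.2⟩

theorem classicalKloosterman_eq (m n c : ℤ) :
    classicalKloosterman m n c =
      ∑ p ∈ inversePairs c, expo ((m : ℝ) * p.1 / c + (n : ℝ) * p.2 / c) := by
  rw [classicalKloosterman, inversePairs]

theorem sum_range_expo (hf : f ≠ 0) (N : ℤ) [Decidable ((f : ℤ) ∣ N)] :
    ∑ w ∈ Finset.range f, expo (N * w / f) = if (f : ℤ) ∣ N then (f : ℂ) else 0 := by
  have hf' : (f : ℝ) ≠ 0 := by exact_mod_cast hf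
  have hpow (w : ℕ) : expo (N * w / f) = expo (N / f) ^ w := by
    rw [expo, expo, ← Complex.exp_nat_mul]
    congr 1
    push_cast
    ring
  simp only [hpow]
  split_ifs with h
  · obtain ⟨k, rfl⟩ := h
    have : expo (((f * k : ℤ) : ℝ) / f) = 1 := by
      rw [← expo_intCast k]
      congr 1
      push_cast
      field_simp
    simp only [this, one_pow]
    simp
  · have hne : expo (N / f) ≠ 1 := by
      intro h1
      rw [expo, Complex.exp_eq_one_iff] at h1
      obtain ⟨k, hk⟩ := h1
      have h2 : (2 * Real.pi * Complex.I : ℂ) ≠ 0 := Complex.two_pi_I_ne_zero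
      rw [mul_comm (k : ℂ)] at hk
      have h3 := mul_left_cancel₀ h2 hk
      have h4 : (N : ℝ) / f = k := by exact_mod_cast h3
      rw [div_eq_iff hf'] at h4
      exact h ⟨k, by rw [mul_comm]; exact_mod_cast h4⟩
    have h1 : expo (N / f) ^ f = 1 := by
      rw [← hpow, ← expo_intCast N]
      congr 1
      field_simp
    rw [geom_sum_eq hne, h1, sub_self, zero_div]

end Residues

/-! ### Parametrization of double cosets and evaluation of the sum. -/

section Counting

/-- Completing `(x₁, d₁; y₁)` and `(x₂, d₂; y₂)` to integral blocks `g₁, g₂` of determinant one, the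
matrix `N = ι_β(g₁)⁻¹ A ι_β(g₂)⁻¹` is integral with `N₁₁ = x₃` and `N₂₁ = f`. The quotient is its
minor `x₃N₂₃ - fN₁₃`. -/
theorem HasCoords.dvd_sub {A : SL(3, ℤ)} (hd₁ : d₁ ≠ 0) (hd₂ : d₂ ≠ 0) (hf : f ≠ 0)
    {x₁ y₂ x₃ y₃ u v x₂ y₁ : ℤ} (h : HasCoords A d₁ d₂ f x₁ y₂ x₃ y₃ u v)
    (h₁ : x₁ * y₁ ≡ 1 [ZMOD d₁]) (h₂ : x₂ * y₂ ≡ 1 [ZMOD d₂]) :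
    d₁ * d₂ ∣ u - (x₃ * d₂ * y₁ + d₁ * x₂) := by
  obtain ⟨⟨-, h01, h02⟩, ⟨-, h11, h12⟩, -, h21, h22⟩ :=
    (toReal_eq_coordMatrix_iff_entries hd₁ hd₂ hf _ ..).1
      ((toReal_eq_coordMatrix_iff hd₁ hd₂ hf ..).2 h)
  obtain ⟨b₁, hb₁⟩ := Int.modEq_iff_dvd.1 h₁.symm
  obtain ⟨b₂, hb₂⟩ := Int.modEq_iff_dvd.1 h₂.symm
  refine ⟨x₃ * (y₁ * (-b₂ * A 1 1 + x₂ * A 1 2) - b₁ * (-b₂ * A 2 1 + x₂ * A 2 2))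
    - f * (-b₂ * A 0 1 + x₂ * A 0 2), ?_⟩
  linear_combination (-(x₃ * y₁ * d₁ * A 1 1) + (x₁ * y₁ - 1) * x₃ * A 2 1 + d₁ * f * A 0 1) * hb₂
    + x₃ * y₁ * (x₂ * y₂ - 1) * h11 - x₃ * y₁ * x₂ * h12
    - x₃ * d₂ * (-b₂ * A 2 1 + x₂ * A 2 2) * hb₁ + (x₁ * y₁ - 1) * x₃ * x₂ * h22
    - (x₁ * y₁ - 1) * x₃ * (x₂ * y₂ - 1) * h21 - (x₂ * y₂ - 1) * h01 + x₂ * h02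

/-- The values of `u` and `v` are those of the block factorization with integral `y₁` and with `x₂ +
d₂w` in place of `x₂`. The congruences for integrality hold even when `x₃y₃ = 1`. -/
theorem exists_mem_stratum_hasCoords (hd₁ : d₁ ≠ 0) (hd₂ : d₂ ≠ 0) (hf : f ≠ 0)
    {x₁ y₁ x₂ y₂ x₃ y₃ : ℤ} (h₃ : x₃ * y₃ ≡ 1 [ZMOD f]) (h₁ : x₁ * y₁ ≡ 1 [ZMOD d₁])
    (h₂ : x₂ * y₂ ≡ 1 [ZMOD d₂]) (w : ℤ) :
    ∃ A ∈ stratum d₁ d₂ f, HasCoords A d₁ d₂ f x₁ y₂ x₃ y₃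
      (x₃ * d₂ * y₁ + d₁ * x₂ + d₁ * d₂ * w)
      (d₁ * y₃ * x₂ + y₁ * d₂ + d₁ * d₂ * y₃ * w) := by
  obtain ⟨b₁, hb₁⟩ := Int.modEq_iff_dvd.1 h₁.symm
  obtain ⟨b₂, hb₂⟩ := Int.modEq_iff_dvd.1 h₂.symm
  obtain ⟨D, hD⟩ := Int.modEq_iff_dvd.1 h₃.symm
  have modEq {a b n c : ℤ} (h : a - b = n * c) : a ≡ b [ZMOD n] :=
    Int.ModEq.symm (Int.modEq_iff_dvd.2 ⟨c, h⟩)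
  obtain ⟨A, -, hA⟩ := (exists_toReal_eq_coordMatrix_iff hd₁ hd₂ hf x₁ y₂ x₃ y₃
    (x₃ * d₂ * y₁ + d₁ * x₂ + d₁ * d₂ * w)
    (d₁ * y₃ * x₂ + y₁ * d₂ + d₁ * d₂ * y₃ * w)).2 ⟨h₃,
      modEq (c := d₂ * b₁ + x₁ * y₃ * (x₂ + d₂ * w)) (by linear_combination d₂ * hb₁),
      modEq (c := d₁ * y₃ * b₂ + y₂ * (y₁ + d₁ * y₃ * w)) (by linear_combination d₁ * y₃ * hb₂),
      modEq (c := D * (x₂ + d₂ * w)) (by linear_combination d₁ * (x₂ + d₂ * w) * hD),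
      modEq (c := x₁ * y₃ * b₂ + y₂ * b₁ + x₁ * y₂ * y₃ * w)
        (by linear_combination x₁ * d₁ * y₃ * hb₂ + y₂ * d₂ * hb₁),
      modEq (c := D * (b₂ + w * y₂))
        (by linear_combination d₁ * (x₂ * y₂ - 1 + d₂ * w * y₂) * hD + d₁ * f * D * hb₂)⟩
  have hc := (toReal_eq_coordMatrix_iff hd₁ hd₂ hf ..).1 hA
  exact ⟨A, hc.mem_stratum (isCoprime_of_mul_modEq_one h₁), hc⟩

/-- The parameters of the double cosets in `Ω_{(β,α,β)}(d₁, d₂, f)`, in the order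
`(x₃, y₃)`, `(y₁, x₁)`, `(x₂, y₂)`, `w`. -/
def parameters (d₁ d₂ : ℤ) (f : ℕ) : Finset ((ℕ × ℕ) × (ℕ × ℕ) × (ℕ × ℕ) × ℕ) :=
  inversePairs f ×ˢ inversePairs d₁ ×ˢ inversePairs d₂ ×ˢ Finset.range f

/-- `A` has the coordinates determined by the parameter `p`. -/
def HasParameter (A : SL(3, ℤ)) (d₁ d₂ : ℤ) (f : ℕ)
    (p : (ℕ × ℕ) × (ℕ × ℕ) × (ℕ × ℕ) × ℕ) : Prop :=
  HasCoords A d₁ d₂ f p.2.1.2 p.2.2.1.2 p.1.1 p.1.2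
    (p.1.1 * d₂ * p.2.1.1 + d₁ * p.2.2.1.1 + d₁ * d₂ * p.2.2.2)
    (d₁ * p.1.2 * p.2.2.1.1 + p.2.1.1 * d₂ + d₁ * d₂ * p.1.2 * p.2.2.2)

theorem mem_parameters {p : (ℕ × ℕ) × (ℕ × ℕ) × (ℕ × ℕ) × ℕ} :
    p ∈ parameters d₁ d₂ f ↔
      p.1 ∈ inversePairs f ∧ p.2.1 ∈ inversePairs d₁ ∧ p.2.2.1 ∈ inversePairs d₂ ∧
        p.2.2.2 < f := by
  simp [parameters]

theorem exists_hasParameter (hd₁ : d₁ ≠ 0) (hd₂ : d₂ ≠ 0) (hf : f ≠ 0) :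
    ∀ p ∈ parameters d₁ d₂ f, ∃ A ∈ stratum d₁ d₂ f, HasParameter A d₁ d₂ f p := by
  intro p hp
  obtain ⟨h3, h1, h2, -⟩ := mem_parameters.1 hp
  exact exists_mem_stratum_hasCoords hd₁ hd₂ hf (mem_inversePairs.1 h3).2
    (mem_inversePairs.1 (swap_mem_inversePairs h1)).2 (mem_inversePairs.1 h2).2 _

theorem eq_of_equivalent (hd₁ : d₁ ≠ 0) (hd₂ : d₂ ≠ 0) (hf : f ≠ 0)
    {p q : (ℕ × ℕ) × (ℕ × ℕ) × (ℕ × ℕ) × ℕ} (hp : p ∈ parameters d₁ d₂ f)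
    (hq : q ∈ parameters d₁ d₂ f) {A B : SL(3, ℤ)} (hAs : A ∈ stratum d₁ d₂ f)
    (hA : HasParameter A d₁ d₂ f p) (hB : HasParameter B d₁ d₂ f q) (h : Equivalent A B) :
    p = q := by
  have hBs := h.symm.mem_stratum hAs
  obtain ⟨hp3, hp1, hp2, hpw⟩ := mem_parameters.1 hp
  obtain ⟨hq3, hq1, hq2, hqw⟩ := mem_parameters.1 hq
  obtain ⟨⟨x₃, y₃⟩, ⟨y₁, x₁⟩, ⟨x₂, y₂⟩, w⟩ := p
  obtain ⟨⟨x₃', y₃'⟩, ⟨y₁', x₁'⟩, ⟨x₂', y₂'⟩, w'⟩ := q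
  rw [mem_inversePairs] at hp3 hp1 hp2 hq3 hq1 hq2
  obtain ⟨⟨p1, p2⟩, p3⟩ := hp3
  obtain ⟨⟨p4, p5⟩, p6⟩ := hp1
  obtain ⟨⟨p7, p8⟩, p9⟩ := hp2
  obtain ⟨⟨q1, q2⟩, q3⟩ := hq3
  obtain ⟨⟨q4, q5⟩, q6⟩ := hq1
  obtain ⟨⟨q7, q8⟩, q9⟩ := hq2
  dsimp only [HasParameter] at *
  obtain ⟨e1, e2⟩ := (exists_equivalent_corner_iff hBs _ _).1
    ⟨A, h, hA.2.2.1, hA.2.2.2.2.2.2.1⟩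
  rw [hB.2.2.1] at e1
  rw [hB.2.2.2.2.2.2.1] at e2
  obtain rfl := nat_eq_of_modEq p1 q1 e1
  obtain rfl := nat_eq_of_modEq p2 q2 e2
  obtain ⟨hu, hx, hy⟩ := (equivalent_iff_of_hasCoords hd₁ hd₂ hf hAs hA hB).1 h
  obtain rfl := nat_eq_of_modEq p5 q5 hx
  obtain rfl := nat_eq_of_modEq p8 q8 hy
  obtain rfl := nat_eq_of_modEq p4 q4
    (modEq_of_mul_modEq_one hx (by rwa [mul_comm]) (by rwa [mul_comm]))
  obtain rfl := nat_eq_of_modEq p7 q7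
    (modEq_of_mul_modEq_one hy (by rwa [mul_comm]) (by rwa [mul_comm]))
  -- All other parameters now agree, so the two values of `u` differ only in the term `d₁d₂w`.
  have hw : (w : ℤ) ≡ w' [ZMOD f] :=
    Int.ModEq.mul_left_cancel' (mul_ne_zero hd₁ hd₂) (Int.ModEq.add_left_cancel' _ hu)
  obtain rfl := nat_eq_of_modEq (c := (f : ℤ)) (by simpa using hpw) (by simpa using hqw) hw
  rfl

/-- Moving `A₁₁` and `M₁₁` to their least residues modulo `f` makes the equivalence criterion
applicable; `w` then records the part of `u` not fixed by `HasCoords.dvd_sub`. -/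
theorem exists_parameter (hd₁ : d₁ ≠ 0) (hd₂ : d₂ ≠ 0) (hf : f ≠ 0) {A : SL(3, ℤ)}
    (hA : A ∈ stratum d₁ d₂ f) :
    ∃ p ∈ parameters d₁ d₂ f, ∀ B, HasParameter B d₁ d₂ f p → Equivalent A B := by
  have hf' : (f : ℤ) ≠ 0 := by exact_mod_cast hf
  obtain ⟨x₃, hx₃, hx₃A⟩ := exists_nat_modEq hf' (A 0 0)
  obtain ⟨y₃, hy₃, hy₃A⟩ := exists_nat_modEq hf'
    (delMinor (A : Matrix (Fin 3) (Fin 3) ℤ) 0 0)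
  obtain ⟨A', hA', a00, m00⟩ := (exists_equivalent_corner_iff hA _ _).2 ⟨hx₃A, hy₃A⟩
  have hA's := hA'.mem_stratum hA
  obtain ⟨x₁, y₂, hc, hx₁, hy₂⟩ := exists_hasCoords hf hA's
  rw [a00, m00] at hc
  obtain ⟨⟨X₁, Y₁⟩, hp₁, hX₁⟩ := exists_inversePair hd₁ hx₁
  obtain ⟨⟨Y₂, X₂⟩, hp₂, hY₂⟩ := exists_inversePair hd₂ hy₂
  have i₁ := (mem_inversePairs.1 hp₁).2
  have i₂ := (mem_inversePairs.1 hp₂).2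
  dsimp only at hX₁ hY₂ i₁ i₂
  obtain ⟨z, hz⟩ := hc.dvd_sub hd₁ hd₂ hf ((hX₁.symm.mul_right _).trans i₁)
    (((mul_comm _ _ : (X₂ : ℤ) * y₂ = _) ▸ (hY₂.symm.mul_right _)).trans i₂)
  obtain ⟨w, hw, hwz⟩ := exists_nat_modEq hf' z
  have h₃ := ((exists_toReal_eq_coordMatrix_iff hd₁ hd₂ hf ..).1
    ⟨A', (stratum_subset hd₁ hd₂ hf hA's).1, (toReal_eq_coordMatrix_iff hd₁ hd₂ hf ..).2 hc⟩).1
  refine ⟨((x₃, y₃), (Y₁, X₁), (X₂, Y₂), w), mem_parameters.2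
    ⟨mem_inversePairs.2 ⟨⟨hx₃, hy₃⟩, h₃⟩, swap_mem_inversePairs hp₁,
      swap_mem_inversePairs hp₂, by simpa using hw⟩, fun B hB => ?_⟩
  refine hA'.symm.trans ((equivalent_iff_of_hasCoords hd₁ hd₂ hf hA's hc hB).2
    ⟨?_, hX₁.symm, hY₂.symm⟩)
  obtain ⟨s, hs⟩ := Int.modEq_iff_dvd.1 hwz
  exact Int.ModEq.symm (Int.modEq_iff_dvd.2 ⟨s, by linear_combination hz + d₁ * d₂ * hs⟩)

theorem mk_eq_mk_iff {A B : SL(3, ℤ)} :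
    DoubleCoset.mk GammaInf GammaInf A = DoubleCoset.mk GammaInf GammaInf B ↔
      Equivalent B A := by
  rw [DoubleCoset.eq]
  rfl

theorem equivalent_out (A : SL(3, ℤ)) :
    Equivalent (DoubleCoset.mk GammaInf GammaInf A).out A :=
  mk_eq_mk_iff.1 (DoubleCoset.out_eq' GammaInf GammaInf _).symm

theorem exists_bijOn_parameters (hd₁ : d₁ ≠ 0) (hd₂ : d₂ ≠ 0) (hf : f ≠ 0) :
    ∃ F : (ℕ × ℕ) × (ℕ × ℕ) × (ℕ × ℕ) × ℕ → SL(3, ℤ),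
      (∀ p ∈ parameters d₁ d₂ f, F p ∈ stratum d₁ d₂ f ∧ HasParameter (F p) d₁ d₂ f p) ∧
      Set.BijOn (fun p => DoubleCoset.mk GammaInf GammaInf (F p)) (parameters d₁ d₂ f)
        (doubleCosets (stratum d₁ d₂ f)) := by
  choose! F hF using exists_hasParameter hd₁ hd₂ hf
  refine ⟨F, hF, ?_, ?_, ?_⟩
  · intro p hp
    exact ⟨F p, (hF p hp).1, rfl⟩
  · intro p hp q hq hpq
    exact eq_of_equivalent hd₁ hd₂ hf hp hq (hF p hp).1 (hF p hp).2 (hF q hq).2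
      (mk_eq_mk_iff.1 hpq).symm
  · rintro _ ⟨A, hA, rfl⟩
    obtain ⟨p, hp, h⟩ := exists_parameter hd₁ hd₂ hf hA
    exact ⟨p, hp, mk_eq_mk_iff.2 (h _ (hF p hp).2)⟩

theorem finite_doubleCosets_stratum (hd₁ : d₁ ≠ 0) (hd₂ : d₂ ≠ 0) (hf : f ≠ 0) :
    (doubleCosets (stratum d₁ d₂ f)).Finite := by
  obtain ⟨F, -, hF⟩ := exists_bijOn_parameters hd₁ hd₂ hf
  rw [← hF.image_eq]
  exact (Finset.finite_toSet _).image _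

theorem HasParameter.phase_eq (hd₁ : d₁ ≠ 0) (hd₂ : d₂ ≠ 0) (hf : f ≠ 0) {A : SL(3, ℤ)}
    {p : (ℕ × ℕ) × (ℕ × ℕ) × (ℕ × ℕ) × ℕ} (h : HasParameter A d₁ d₂ f p) (m n : Fin 2 → ℤ) :
    phase m n (d₁ * f) (d₂ * f) A =
      (((n 0 * d₂ + p.1.1 * m 0 * d₁) / f * p.2.1.1 / d₁ + m 1 * p.2.1.2 / d₁) +
        ((n 0 * d₂ * p.1.2 + m 0 * d₁) / f * p.2.2.1.1 / d₂ + n 1 * p.2.2.1.2 / d₂)) +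
      ((n 0 * d₂ * p.1.2 + m 0 * d₁ : ℤ) : ℝ) * p.2.2.2 / f := by
  have h1 : (d₁ : ℝ) ≠ 0 := by exact_mod_cast hd₁
  have h2 : (d₂ : ℝ) ≠ 0 := by exact_mod_cast hd₂
  have h3 : (f : ℝ) ≠ 0 := by exact_mod_cast hf
  obtain ⟨-, a10, -, a21, -, m01, -, m12⟩ := h
  rw [phase, a10, a21, m01, m12]
  push_cast
  field_simp
  ring

theorem fineKloostermanSum_eq_sum_parameters (hd₁ : d₁ ≠ 0) (hd₂ : d₂ ≠ 0) (hf : f ≠ 0)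
    (m n : Fin 2 → ℤ) :
    fineKloostermanSum m n d₁ d₂ f = ∑ p ∈ parameters d₁ d₂ f,
      expo ((((n 0 * d₂ + p.1.1 * m 0 * d₁) / f * p.2.1.1 / d₁ + m 1 * p.2.1.2 / d₁) +
        ((n 0 * d₂ * p.1.2 + m 0 * d₁) / f * p.2.2.1.1 / d₂ + n 1 * p.2.2.1.2 / d₂)) +
      ((n 0 * d₂ * p.1.2 + m 0 * d₁ : ℤ) : ℝ) * p.2.2.2 / f) := by
  obtain ⟨F, hF, hbij⟩ := exists_bijOn_parameters hd₁ hd₂ hf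
  rw [fineKloostermanSum, kloostermanSumOver, ← finsum_mem_coe_finset]
  symm
  refine finsum_mem_eq_of_bijOn _ hbij fun p hp => ?_
  obtain ⟨hs, hp⟩ := hF p hp
  have he := equivalent_out (F p)
  rw [← hp.phase_eq hd₁ hd₂ hf, kloostermanTerm_eq hd₁ hd₂ hf (he.mem_stratum hs),
    he.expo_phase_eq hd₁ hd₂ hf hs]

/-- The two components of the pair are inverse modulo `f`, so multiplication by one or the other
passes between the two conditions. -/
theorem dvd_iff_of_mem_inversePairs {p : ℕ × ℕ} (hp : p ∈ inversePairs f) (a b : ℤ) :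
    (f : ℤ) ∣ a * p.2 + b ↔ a + p.1 * b ≡ 0 [ZMOD f] := by
  obtain ⟨D, hD⟩ := Int.modEq_iff_dvd.1 (mem_inversePairs.1 hp).2
  rw [Int.modEq_zero_iff_dvd]
  constructor
  · rintro ⟨k, hk⟩
    exact ⟨p.1 * k + D * a, by linear_combination p.1 * hk + a * hD⟩
  · rintro ⟨k, hk⟩
    exact ⟨p.2 * k + D * b, by linear_combination p.2 * hk + b * hD⟩

theorem fineKloostermanSum_eq (hd₁ : d₁ ≠ 0) (hd₂ : d₂ ≠ 0) (hf : f ≠ 0) (m n : Fin 2 → ℤ) :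
    fineKloostermanSum m n d₁ d₂ f =
      f * ∑ p ∈ (inversePairs f).filter
          (fun p : ℕ × ℕ => n 0 * d₂ + p.1 * m 0 * d₁ ≡ 0 [ZMOD f]),
        classicalKloosterman ((n 0 * d₂ + p.1 * m 0 * d₁) / f) (m 1) d₁ *
        classicalKloosterman ((n 0 * d₂ * p.2 + m 0 * d₁) / f) (n 1) d₂ := by
  have hf' : (f : ℝ) ≠ 0 := by exact_mod_cast hf
  rw [fineKloostermanSum_eq_sum_parameters hd₁ hd₂ hf, parameters, Finset.sum_product,
    Finset.sum_filter, Finset.mul_sum]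
  refine Finset.sum_congr rfl fun p hp => ?_
  have hiff := dvd_iff_of_mem_inversePairs hp (n 0 * d₂) (m 0 * d₁)
  rw [← mul_assoc] at hiff
  simp only [Finset.sum_product, expo_add _ (_ / (f : ℝ)), ← Finset.mul_sum,
    sum_range_expo hf, ← Finset.sum_mul]
  split_ifs with h1 h2 h2
  -- Both numerators are divisible by `f`, so the real quotients in the phase agree with the integer
  -- quotients in the Kloosterman sums.
  · obtain ⟨k, hk⟩ := h1
    obtain ⟨l, hl⟩ := Int.modEq_zero_iff_dvd.1 h2
    have hfz : (f : ℤ) ≠ 0 := by exact_mod_cast hf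
    have hk' : ((n 0 : ℝ) * d₂ * p.2 + m 0 * d₁) / f = k := by
      rw [div_eq_iff hf', mul_comm (k : ℝ)]
      exact_mod_cast hk
    have hl' : ((n 0 : ℝ) * d₂ + p.1 * m 0 * d₁) / f = l := by
      rw [div_eq_iff hf', mul_comm (l : ℝ)]
      exact_mod_cast hl
    rw [hk, hl, Int.mul_ediv_cancel_left _ hfz, Int.mul_ediv_cancel_left _ hfz,
      classicalKloosterman_eq, classicalKloosterman_eq, Finset.sum_mul_sum, mul_comm]
    simp only [hk', hl', expo_add (_ + _) (_ + _)]
  · exact absurd (hiff.1 h1) h2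
  · exact absurd (hiff.2 h2) h1
  · simp

end Counting

end SL3Kloosterman

open SL3Kloosterman in
theorem proposition5p12 :
    -- the two greatest common divisors agree on the big cell
    (∀ A ∈ bigCell, Int.gcd (A 2 0) (A 1 0) =
      Int.gcd (delMinor (A : Matrix (Fin 3) (Fin 3) ℤ) 0 2)
        (delMinor (A : Matrix (Fin 3) (Fin 3) ℤ) 0 1)) ∧
    ∀ (d₁ d₂ : ℤ) (f : ℕ), d₁ ≠ 0 → d₂ ≠ 0 → f ≠ 0 →
    -- the stratum is contained in the coarse set and is invariant on both sides
    (stratum d₁ d₂ f ⊆ bigCell ∩ coarseSet (d₁ * f) (d₂ * f)) ∧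
    (∀ A ∈ stratum d₁ d₂ f, ∀ g ∈ GammaInf,
      g * A ∈ stratum d₁ d₂ f ∧ A * g ∈ stratum d₁ d₂ f) ∧
    -- every double coset has a representative with `D ≠ 0`
    (∀ A ∈ stratum d₁ d₂ f, ∃ A' : SL(3, ℤ), Equivalent A' A ∧
      A' 0 0 * delMinor (A' : Matrix (Fin 3) (Fin 3) ℤ) 0 0 - 1 ≠ 0) ∧
    -- explicit factorization and Bruhat coordinates when `D ≠ 0`
    (∀ A ∈ stratum d₁ d₂ f,
      A 0 0 * delMinor (A : Matrix (Fin 3) (Fin 3) ℤ) 0 0 - 1 ≠ 0 →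
      ∃ D : ℤ, f * D = A 0 0 * delMinor (A : Matrix (Fin 3) (Fin 3) ℤ) 0 0 - 1 ∧
      toReal A =
        eBeta ((toReal A 1 0 / f) / d₁) * sBeta * hBeta d₁ *
            eBeta ((delMinor (toReal A) 1 0 / D) / d₁) *
          (eAlpha (toReal A 0 0 / f) * sAlpha * hAlpha f *
            eAlpha (delMinor (toReal A) 0 0 / f)) *
          (eBeta ((toReal A 0 1 / D) / d₂) * sBeta * hBeta d₂ *
            eBeta ((delMinor (toReal A) 0 1 / f) / d₂)) ∧
      ∃ (x₁ y₂ x₃ y₃ u v : ℤ) (x₂ y₁ : ℝ),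
        (x₁ : ℝ) = toReal A 1 0 / f ∧ y₁ = delMinor (toReal A) 1 0 / D ∧
        x₂ = toReal A 0 1 / D ∧ (y₂ : ℝ) = delMinor (toReal A) 0 1 / f ∧
        x₃ = A 0 0 ∧ y₃ = delMinor (A : Matrix (Fin 3) (Fin 3) ℤ) 0 0 ∧
        (u : ℝ) = x₂ * d₁ + x₃ * d₂ * y₁ ∧ (v : ℝ) = x₂ * d₁ * y₃ + d₂ * y₁ ∧
        toReal A =
          iotaBeta !![(x₁ : ℝ), (x₁ * y₁ - 1) / d₁; (d₁ : ℝ), y₁] *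
          iotaAlpha !![(x₃ : ℝ), (D : ℝ); (f : ℝ), (y₃ : ℝ)] *
          iotaBeta !![x₂, (x₂ * y₂ - 1) / d₂; (d₂ : ℝ), (y₂ : ℝ)] ∧
        toReal A = coordMatrix d₁ d₂ f x₁ y₂ x₃ y₃ u v) ∧
    -- which integral coordinates give an integral matrix
    (∀ x₁ y₂ x₃ y₃ u v : ℤ,
      (∃ A ∈ bigCell, toReal A = coordMatrix d₁ d₂ f x₁ y₂ x₃ y₃ u v) ↔
        x₃ * y₃ ≡ 1 [ZMOD f] ∧
        x₁ * v ≡ d₂ [ZMOD d₁] ∧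
        y₂ * v ≡ y₃ * d₁ [ZMOD d₂] ∧
        x₃ * v ≡ u [ZMOD (d₁ * f)] ∧
        x₁ * y₂ * v ≡ y₃ * x₁ * d₁ + y₂ * d₂ [ZMOD (d₁ * d₂)] ∧
        x₃ * y₂ * v + d₁ * (1 - x₃ * y₃) ≡ u * y₂ [ZMOD (d₁ * d₂ * f)]) ∧
    -- `x₃ = A₁₁` and `y₃ = M₁₁` matter, and can be prescribed, exactly modulo `f`
    (∀ A ∈ stratum d₁ d₂ f, ∀ x₃ y₃ : ℤ,
      (∃ A' : SL(3, ℤ), Equivalent A' A ∧ A' 0 0 = x₃ ∧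
        delMinor (A' : Matrix (Fin 3) (Fin 3) ℤ) 0 0 = y₃) ↔
        x₃ ≡ A 0 0 [ZMOD f] ∧
        y₃ ≡ delMinor (A : Matrix (Fin 3) (Fin 3) ℤ) 0 0 [ZMOD f]) ∧
    -- when two sets of coordinates give the same double coset
    (∀ (x₃ y₃ x₁ y₂ u v X₁ Y₂ U V : ℤ) (A B : SL(3, ℤ)), A ∈ stratum d₁ d₂ f →
      toReal A = coordMatrix d₁ d₂ f x₁ y₂ x₃ y₃ u v →
      toReal B = coordMatrix d₁ d₂ f X₁ Y₂ x₃ y₃ U V →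
      (Equivalent A B ↔
        u ≡ U [ZMOD (d₁ * d₂ * f)] ∧ x₁ ≡ X₁ [ZMOD d₁] ∧ y₂ ≡ Y₂ [ZMOD d₂])) ∧
    -- the fine Kloosterman sum is a well-defined finite sum, and its evaluation
    (doubleCosets (stratum d₁ d₂ f)).Finite ∧
    ∀ m n : Fin 2 → ℤ,
      (∀ A ∈ stratum d₁ d₂ f, ∀ B ∈ stratum d₁ d₂ f, Equivalent A B →
        ∀ uL uR uL' uR', IsBruhat A (d₁ * f) (d₂ * f) uL uR →
          IsBruhat B (d₁ * f) (d₂ * f) uL' uR' →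
          psi m uL * psi n uR = psi m uL' * psi n uR') ∧
      fineKloostermanSum m n d₁ d₂ f =
        f * ∑ p ∈ (Finset.range f ×ˢ Finset.range f).filter (fun p : ℕ × ℕ =>
              (p.1 : ℤ) * p.2 ≡ 1 [ZMOD f] ∧
              n 0 * d₂ + p.1 * m 0 * d₁ ≡ 0 [ZMOD f]),
            classicalKloosterman ((n 0 * d₂ + p.1 * m 0 * d₁) / f) (m 1) d₁ *
            classicalKloosterman ((n 0 * d₂ * p.2 + m 0 * d₁) / f) (n 1) d₂ := by

  refine ⟨fun A _ => gcd_column_eq_gcd_minors A, fun d₁ d₂ f hd₁ hd₂ hf =>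
    ⟨stratum_subset hd₁ hd₂ hf, ?_, fun A hA => exists_equivalent_ne_zero hd₁ hf hA, ?_,
      exists_toReal_eq_coordMatrix_iff hd₁ hd₂ hf,
      fun A hA => exists_equivalent_corner_iff hA, ?_,
      finite_doubleCosets_stratum hd₁ hd₂ hf, fun m n => ⟨?_, ?_⟩⟩⟩
  · intro A hA g hg
    exact ⟨Equivalent.mem_stratum ⟨g, hg, 1, one_mem _, (mul_one _).symm⟩ hA,
      Equivalent.mem_stratum ⟨1, one_mem _, g, hg, by rw [one_mul]⟩ hA⟩
  · intro A hA hne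
    have hf' : (f : ℝ) ≠ 0 := by exact_mod_cast hf
    have r1 : (d₁ : ℝ) ≠ 0 := by exact_mod_cast hd₁
    have r2 : (d₂ : ℝ) ≠ 0 := by exact_mod_cast hd₂
    obtain ⟨x₁, y₂, h, -⟩ := exists_hasCoords hf hA
    have hcoord := (toReal_eq_coordMatrix_iff hd₁ hd₂ hf ..).2 h
    have hmod := ((exists_toReal_eq_coordMatrix_iff hd₁ hd₂ hf ..).1
      ⟨A, (stratum_subset hd₁ hd₂ hf hA).1, hcoord⟩).1
    -- `D` is the quotient in the congruence `x₃y₃ ≡ 1` modulo `f`.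
    obtain ⟨D, hD⟩ := Int.modEq_iff_dvd.1 hmod.symm
    have hD0 : D ≠ 0 := by
      rintro rfl
      exact hne (by simpa using hD)
    have hcfD : (f : ℝ) * D = A 0 0 * (delMinor (A : Matrix (Fin 3) (Fin 3) ℤ) 0 0 : ℤ) - 1 := by
      exact_mod_cast hD.symm
    obtain ⟨hu, hv, hA'⟩ := h.toReal_eq_iota_mul hd₁ hd₂ hf hD0 hD.symm rfl rfl
    have hx₁ : (x₁ : ℝ) = toReal A 1 0 / f := by
      rw [toReal_apply, h.2.1]
      push_cast
      field_simp
    have hy₂ : (y₂ : ℝ) = delMinor (toReal A) 0 1 / f := by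
      rw [delMinor_toReal, h.2.2.2.2.2.1]
      push_cast
      field_simp
    refine ⟨D, hD.symm, ?_, x₁, y₂, A 0 0, delMinor (A : Matrix (Fin 3) (Fin 3) ℤ) 0 0, _, _,
      toReal A 0 1 / D, delMinor (toReal A) 1 0 / D, hx₁, rfl, rfl, hy₂, rfl, rfl, ?_, ?_, ?_,
      hcoord⟩
    · rw [eBeta_mul_sBeta_mul_hBeta_mul_eBeta r1, eBeta_mul_sBeta_mul_hBeta_mul_eBeta r2,
        eAlpha_mul_sAlpha_mul_hAlpha_mul_eAlpha hf', ← hx₁, ← hy₂]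
      simp only [delMinor_toReal]
      rw [toReal_apply A 0 0, ← hcfD, mul_div_cancel_left₀ _ hf']
      exact hA'
    · rw [delMinor_toReal]
      exact hu
    · rw [delMinor_toReal]
      exact hv
    · rw [delMinor_toReal]
      exact hA'
  · intro x₃ y₃ x₁ y₂ u v X₁ Y₂ U V A B hA h h'
    exact equivalent_iff_of_hasCoords hd₁ hd₂ hf hA
      ((toReal_eq_coordMatrix_iff hd₁ hd₂ hf ..).1 h)
      ((toReal_eq_coordMatrix_iff hd₁ hd₂ hf ..).1 h')
  · intro A hA B hB hAB uL uR uL' uR' h h'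
    have hf' : (f : ℤ) ≠ 0 := by exact_mod_cast hf
    rw [h.psi_mul_psi (mul_ne_zero hd₁ hf') (mul_ne_zero hd₂ hf'),
      h'.psi_mul_psi (mul_ne_zero hd₁ hf') (mul_ne_zero hd₂ hf'),
      hAB.expo_phase_eq hd₁ hd₂ hf hB]
  · rw [fineKloostermanSum_eq hd₁ hd₂ hf, inversePairs, Finset.filter_filter, Int.natAbs_natCast]
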